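/- **Setting.** For integers $n,k\ge 1$, the Razak block $A_{n,k}$ is the C*-algebra of all $f\in C([0,1],M_{nk})$ for which there is a matrix $a\in M_k$, denoted $a_f$, with $f(0)=\mathrm{diag}(\underbrace{a,\dots,a}_{n})$ and $f(1)=\mathrm{diag}(\underbrace{a,\dots,a}_{n-1},0_k)$. A trace on $A_{n,k}$ is a tracial state. It is faithful if it vanishes on $ff^*$ only for $f=0$, and diffuse if it has the form $f\mapsto\int \tau_{nk}(f(t))\,d\mu(t)$ for an atomless Borel probability measure $\mu$ on $(0,1)$, where $\tau_{nk}$ is the normalised trace on $M_{nk}$. The set of faithful diffuse traces is denoted $T_{fd}(A_{n,k})$, and $\lambda\in T_{fd}(A_{n,k})$ is the trace given by Lebesgue measure. We write $\varphi\colon(A,\sigma)\to(B,\tau)$ for a $*$-homomorphism $\varphi\colon A\to B$ with $\sigma=\tau\circ\varphi$. For a $*$-homomorphism $\varphi\colon A\to B$ into a Razak block $B$, let $\pi_{\varphi,t}(f)=\varphi(f)(t)$ for $t\in(0,1)$ and $\pi_{\varphi,\infty}(f)=a_{\varphi(f)}$. For $*$-homomorphisms $\pi,\rho$ from $A$ into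 a matrix algebra $M_m$ and $G\subseteq A$, the unitary distance relative to $G$ is $$d_{\mathcal U}^G(\pi,\rho)=\inf_{u\in\mathcal U(M_m)}\ \sup_{f\in G}\ \|\pi(f)-u\rho(f)u^*\|,$$ where $\|\cdot\|$ is the operator norm. **Theorem.** Let $A,B,C$ be Razak blocks, $\sigma\in T_{fd}(A)$, $\tau_1\in T_{fd}(B)$, $\tau_2\in T_{fd}(C)$, and let $\varphi_1\colon(A,\sigma)\to(B,\tau_1)$ and $\varphi_2\colon(A,\sigma)\to(C,\tau_2)$ be $*$-homomorphisms. Let $G\subseteq A$ be finite and let $\varepsilon>0$. Then there are a Razak block $D$ and $*$-homomorphisms $\psi_1\colon(B,\tau_1)\to(D,\lambda)$ and $\psi_2\colon(C,\tau_2)\to(D,\lambda)$ such that $$\sup_{t\in(0,1)\cup\{\infty\}} d_{\mathcal U}^G\bigl(\pi_{\psi_1\circ\varphi_1,t},\,\pi_{\psi_2\circ\varphi_2,t}\bigr)<\varepsilon .$$ -/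

import Mathlib

open MeasureTheory
open scoped ENNReal Matrix.Norms.L2Operator ComplexOrder

/-- The Razak block `A_{n,k}`: the continuous functions `f : [0,1] → M_{nk}` such that, for some
`a ∈ M_k`, `f 0 = diag(a, …, a)` (`n` copies) and `f 1 = diag(a, …, a, 0_k)` (`n - 1` copies).
The matrices in `M_{nk}` are indexed by `Fin k × Fin n`, the second coordinate numbering the
diagonal blocks, and all matrix algebras carry the operator norm. -/
def razakSubalgebra (n k : ℕ) :
    NonUnitalStarSubalgebra ℂ C(unitInterval, Matrix (Fin k × Fin n) (Fin k × Fin n) ℂ) where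
  carrier := {f | ∃ a : Matrix (Fin k) (Fin k) ℂ,
    f 0 = Matrix.blockDiagonal (fun _ : Fin n => a) ∧
    f 1 = Matrix.blockDiagonal (fun i : Fin n => if (i : ℕ) + 1 < n then a else 0)}
  zero_mem' := by
    refine ⟨0, ?_, ?_⟩
    · exact Matrix.blockDiagonal_zero.symm
    · simp only [ite_self]
      exact Matrix.blockDiagonal_zero.symm
  add_mem' := by
    rintro f g ⟨a, hf0, hf1⟩ ⟨b, hg0, hg1⟩
    refine ⟨a + b, ?_, ?_⟩
    · rw [ContinuousMap.add_apply, hf0, hg0, ← Matrix.blockDiagonal_add]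
      rfl
    · rw [ContinuousMap.add_apply, hf1, hg1, ← Matrix.blockDiagonal_add]
      congr 1
      funext i
      by_cases h : (i : ℕ) + 1 < n <;> simp [h]
  mul_mem' := by
    rintro f g ⟨a, hf0, hf1⟩ ⟨b, hg0, hg1⟩
    refine ⟨a * b, ?_, ?_⟩
    · rw [ContinuousMap.mul_apply, hf0, hg0, ← Matrix.blockDiagonal_mul]
    · rw [ContinuousMap.mul_apply, hf1, hg1, ← Matrix.blockDiagonal_mul]
      congr 1
      funext i
      by_cases h : (i : ℕ) + 1 < n <;> simp [h]
  smul_mem' := by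
    rintro c f ⟨a, hf0, hf1⟩
    refine ⟨c • a, ?_, ?_⟩
    · rw [ContinuousMap.smul_apply, hf0, ← Matrix.blockDiagonal_smul]
      rfl
    · rw [ContinuousMap.smul_apply, hf1, ← Matrix.blockDiagonal_smul]
      congr 1
      funext i
      by_cases h : (i : ℕ) + 1 < n <;> simp [h]
  star_mem' := by
    rintro f ⟨a, hf0, hf1⟩
    refine ⟨star a, ?_, ?_⟩
    · rw [ContinuousMap.star_apply, hf0, Matrix.star_eq_conjTranspose,
        Matrix.blockDiagonal_conjTranspose]
      rfl
    · rw [ContinuousMap.star_apply, hf1, Matrix.star_eq_conjTranspose,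
        Matrix.blockDiagonal_conjTranspose]
      congr 1
      funext i
      by_cases h : (i : ℕ) + 1 < n <;> simp [h, Matrix.star_eq_conjTranspose]

theorem isClosed_razakSubalgebra (n k : ℕ) :
    IsClosed (razakSubalgebra n k :
      Set C(unitInterval, Matrix (Fin k × Fin n) (Fin k × Fin n) ℂ)) := by
  have h : (razakSubalgebra n k : Set C(unitInterval, Matrix (Fin k × Fin n) (Fin k × Fin n) ℂ)) =
      ⋂ i₀ : Fin n, {f | f 0 = Matrix.blockDiagonal (fun _ => Matrix.blockDiag (f 0) i₀) ∧
        f 1 = Matrix.blockDiagonal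
          (fun i : Fin n => if (i : ℕ) + 1 < n then Matrix.blockDiag (f 0) i₀ else 0)} := by
    ext f
    simp only [Set.mem_iInter, Set.mem_ofPred_eq]
    constructor
    · rintro ⟨a, h0, h1⟩ i₀
      have ha : Matrix.blockDiag (f 0) i₀ = a := by rw [h0, Matrix.blockDiag_blockDiagonal]
      rw [ha]
      exact ⟨h0, h1⟩
    · intro hf
      rcases Nat.eq_zero_or_pos n with rfl | hn
      · refine ⟨0, ?_, ?_⟩ <;> · ext ⟨_, i⟩; exact i.elim0
      · exact ⟨_, hf ⟨0, hn⟩⟩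
  rw [h]
  refine isClosed_iInter fun i₀ => IsClosed.inter ?_ ?_
  · refine isClosed_eq (by fun_prop) ?_
    refine Continuous.matrix_blockDiagonal (continuous_pi fun _ => ?_)
    exact (continuous_apply i₀).comp (Continuous.matrix_blockDiag (by fun_prop))
  · refine isClosed_eq (by fun_prop) ?_
    refine Continuous.matrix_blockDiagonal (continuous_pi fun i => ?_)
    split_ifs
    · exact (continuous_apply i₀).comp (Continuous.matrix_blockDiag (by fun_prop))
    · exact continuous_const

/-- The Razak block `A_{n,k}`, a C*-algebra. -/
abbrev RazakBlock (n k : ℕ) : Type := ↥(razakSubalgebra n k)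

noncomputable instance razakCStarAlgebra (n k : ℕ) : NonUnitalCStarAlgebra (RazakBlock n k) :=
  haveI : IsClosed (razakSubalgebra n k :
      Set C(unitInterval, Matrix (Fin k × Fin n) (Fin k × Fin n) ℂ)) :=
    isClosed_razakSubalgebra n k
  inferInstance

/-- The point representation `f ↦ f t` of `A_{n,k}` on `M_{nk}`, for `t ∈ [0,1]`. -/
noncomputable def pointRep {n k : ℕ} (t : unitInterval) :
    RazakBlock n k →⋆ₙₐ[ℂ] Matrix (Fin k × Fin n) (Fin k × Fin n) ℂ where
  toFun f := f.1 t
  map_smul' _ _ := rfl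
  map_zero' := rfl
  map_add' _ _ := rfl
  map_mul' _ _ := rfl
  map_star' _ := rfl

theorem razakBlock_apply_zero {n k : ℕ} [NeZero n] (f : RazakBlock n k) :
    f.1 0 = Matrix.blockDiagonal (fun _ : Fin n => Matrix.blockDiag (f.1 0) 0) := by
  obtain ⟨a, h0, -⟩ := f.2
  rw [h0, Matrix.blockDiag_blockDiagonal]

/-- The representation at infinity `f ↦ a_f` of `A_{n,k}` on `M_k`, where
`f 0 = diag(a_f, …, a_f)`: the matrix `a_f` is the first diagonal block of `f 0`. -/
noncomputable def inftyRep {n k : ℕ} [NeZero n] : RazakBlock n k →⋆ₙₐ[ℂ] Matrix (Fin k) (Fin k) ℂ where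
  toFun f := Matrix.blockDiag (f.1 0) 0
  map_smul' _ _ := rfl
  map_zero' := rfl
  map_add' _ _ := rfl
  map_mul' f g := by
    have h : (f * g).1 0 = f.1 0 * g.1 0 := rfl
    rw [h, razakBlock_apply_zero f, razakBlock_apply_zero g, ← Matrix.blockDiagonal_mul]
    simp only [Matrix.blockDiag_blockDiagonal]
  map_star' _ := rfl

/-- The characterising property of the representation at infinity: `f 0 = diag(a_f, …, a_f)`. -/
theorem pointRep_zero {n k : ℕ} [NeZero n] (f : RazakBlock n k) :
    pointRep 0 f = Matrix.blockDiagonal (fun _ : Fin n => inftyRep f) :=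
  razakBlock_apply_zero f

/-- The normalised trace on `M_ι`. -/
noncomputable def normTrace (ι : Type) [Fintype ι] [DecidableEq ι] : Matrix ι ι ℂ →L[ℂ] ℂ :=
  LinearMap.toContinuousLinearMap ((Fintype.card ι : ℂ)⁻¹ • Matrix.traceLinearMap ι ℂ ℂ)

/-- The functional `f ↦ ∫ τ_{nk}(f t) dμ(t)` on `A_{n,k}` given by a finite Borel measure `μ` on
`[0,1]`, where `τ_{nk}` is the normalised trace on `M_{nk}`. -/
noncomputable def measureTrace (n k : ℕ) (μ : Measure unitInterval) [IsFiniteMeasure μ] :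
    RazakBlock n k →L[ℂ] ℂ :=
  LinearMap.mkContinuous
    { toFun := fun f => ∫ t, normTrace (Fin k × Fin n) (f.1 t) ∂μ
      map_add' := fun f g => by
        have hi : ∀ h : RazakBlock n k,
            Integrable (fun t => normTrace (Fin k × Fin n) (h.1 t)) μ := fun h =>
          ((normTrace (Fin k × Fin n)).continuous.comp
            (map_continuous h.1)).integrable_of_hasCompactSupport (HasCompactSupport.of_compactSpace _)
        rw [← integral_add (hi f) (hi g)]
        refine integral_congr_ae (Filter.Eventually.of_forall fun t => ?_)
        exact map_add (normTrace (Fin k × Fin n)) (f.1 t) (g.1 t)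
      map_smul' := fun c f => by
        rw [RingHom.id_apply, ← integral_smul]
        refine integral_congr_ae (Filter.Eventually.of_forall fun t => ?_)
        exact map_smul (normTrace (Fin k × Fin n)) c (f.1 t) }
    (‖normTrace (Fin k × Fin n)‖ * μ.real Set.univ) (fun f => by
      have hb : ∀ t : unitInterval, ‖normTrace (Fin k × Fin n) (f.1 t)‖
          ≤ ‖normTrace (Fin k × Fin n)‖ * ‖f‖ := fun t =>
        ((normTrace (Fin k × Fin n)).le_opNorm (f.1 t)).trans
          (mul_le_mul_of_nonneg_left (f.1.norm_coe_le_norm t) (norm_nonneg _))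
      refine (norm_integral_le_of_norm_le_const (Filter.Eventually.of_forall hb)).trans
        (le_of_eq ?_)
      ring)

/-- The Lebesgue trace `λ` on `A_{n,k}`: `λ(f) = ∫₀¹ τ_{nk}(f t) dt`. -/
noncomputable def lebesgueTrace (n k : ℕ) : RazakBlock n k →L[ℂ] ℂ :=
  measureTrace n k (volume : Measure unitInterval)

/-- A trace on a Razak block is a tracial state: a positive linear functional of norm one with
`τ (a * b) = τ (b * a)`. -/
structure IsTrace {n k : ℕ} (τ : RazakBlock n k →L[ℂ] ℂ) : Prop where
  nonneg : ∀ a, 0 ≤ τ (star a * a)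
  norm_eq_one : ‖τ‖ = 1
  tracial : ∀ a b, τ (a * b) = τ (b * a)

/-- A functional is faithful if it vanishes on `f f*` only for `f = 0`. -/
def IsFaithful {n k : ℕ} (τ : RazakBlock n k →L[ℂ] ℂ) : Prop :=
  ∀ f, τ (f * star f) = 0 ↔ f = 0

/-- A functional is diffuse if it is the one associated with an atomless Borel probability
measure. (An atomless measure on `[0,1]` is the same as one on `(0,1)`.) -/
def IsDiffuse {n k : ℕ} (τ : RazakBlock n k →L[ℂ] ℂ) : Prop :=
  ∃ (μ : Measure unitInterval) (_ : IsProbabilityMeasure μ), (∀ t, μ {t} = 0) ∧ τ = measureTrace n k μ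

/-- Membership in `T_{fd}(A_{n,k})`: `τ` is a faithful diffuse trace. -/
structure IsFaithfulDiffuseTrace {n k : ℕ} (τ : RazakBlock n k →L[ℂ] ℂ) : Prop where
  isTrace : IsTrace τ
  faithful : IsFaithful τ
  diffuse : IsDiffuse τ

/-- `φ : (A, σ) → (B, τ)`, that is, `σ = τ ∘ φ`. -/
def SendsTrace {n k n' k' : ℕ} (φ : RazakBlock n k →⋆ₙₐ[ℂ] RazakBlock n' k')
    (σ : RazakBlock n k →L[ℂ] ℂ) (τ : RazakBlock n' k' →L[ℂ] ℂ) : Prop :=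
  ∀ a, σ a = τ (φ a)

/-- The unitary distance relative to `G` between two `*`-homomorphisms into a unital
C*-algebra `B` (which is its own unitisation), with values in `[0, ∞]`:
`inf_u sup_{f ∈ G} ‖φ(f) - u ψ(f) u*‖` over the unitaries `u` of `B`. -/
noncomputable def unitaryDist {A B : Type*} [NonUnitalCStarAlgebra A] [CStarAlgebra B]
    (G : Set A) (φ ψ : A →⋆ₙₐ[ℂ] B) : ℝ≥0∞ :=
  ⨅ u : unitary B, ⨆ f ∈ G, ‖φ f - (u : B) * ψ f * star (u : B)‖ₑ

/-! Traces decide everything here. Up to unitary equivalence, a representation of $A_{n,k}$ on a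
matrix algebra is a direct sum of evaluations at interior points, copies of the representation at
infinity and a zero block (`exists_uEquiv_stdRep`), and trace and dimension determine the
multiplicities (`uEquiv_of_trace_eq`). In particular evaluation at 0 is n copies of infinity, and
evaluation at 1 is n-1 copies of infinity plus a zero block of size k.

Uniqueness (`exists_uNear_of_trace_close`): let the normalised traces of two representations on the
same matrix algebra both be close to σ on the elements diag(1, …, 1, 1 - ramp). Faithfulness makes σ
strictly increasing along consecutive ramps. So the two representations have, up to a shift of order
1/M, comparable numbers of points to the right of any threshold, where the zero block is counted as
mass at 1. After points near 1 are pushed to 1 and the endpoint relations are used to trade copies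
of infinity and zeros for points at 0 and 1, both have equally many points and the same remainder.
Matching the points in increasing order moves each of them only slightly.

Existence (`exists_hom_lebesgueTrace`): reparametrise by the quantile function, so that τ becomes an
integral against Lebesgue measure, and cut [0,1] into L short cells. Take N copies of the direct
sum, over the cells, of evaluations along a path inside each cell; every path either rises through
its cell or goes up and comes back. Each path spreads Lebesgue measure uniformly over its cell, so λ
pulls back to τ, and every single fibre already has trace close to τ. The numbers of rising paths
are chosen so that the boundary condition at 1 holds up to unitary equivalence, and a path of
unitaries repairs it.

For the theorem, send B and C into one common D by such maps. Every fibre of either composition has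
trace close to σ on the finite test set, including the fibre at infinity, so uniqueness applies
fibre by fibre. -/

set_option linter.unusedSectionVars false

/-! ### Unitary equivalence and direct sums of representations -/

section UnitaryEquivalence

variable {A : Type*} [NonUnitalCStarAlgebra A]
variable {ι ι' ι'' κ X : Type} [Fintype ι] [DecidableEq ι] [Fintype ι'] [DecidableEq ι']
  [Fintype ι''] [DecidableEq ι''] [Fintype κ] [DecidableEq κ] [Fintype X] [DecidableEq X]

/-- Unitary equivalence of two representations on matrix algebras. -/
def UEquiv (π : A →⋆ₙₐ[ℂ] Matrix ι ι ℂ) (ρ : A →⋆ₙₐ[ℂ] Matrix ι' ι' ℂ) : Prop :=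
  ∃ u : Matrix ι ι' ℂ, u * u.conjTranspose = 1 ∧ u.conjTranspose * u = 1 ∧
    ∀ f, π f = u * ρ f * u.conjTranspose

theorem UEquiv.symm {π : A →⋆ₙₐ[ℂ] Matrix ι ι ℂ} {ρ : A →⋆ₙₐ[ℂ] Matrix ι' ι' ℂ}
    (h : UEquiv π ρ) : UEquiv ρ π := by
  obtain ⟨u, h1, h2, h3⟩ := h
  refine ⟨u.conjTranspose, by simpa using h2, by simpa using h1, fun f => ?_⟩
  rw [h3, Matrix.conjTranspose_conjTranspose, ← Matrix.mul_assoc, ← Matrix.mul_assoc, h2,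
    Matrix.one_mul, Matrix.mul_assoc, h2, Matrix.mul_one]

theorem UEquiv.trans {π : A →⋆ₙₐ[ℂ] Matrix ι ι ℂ} {ρ : A →⋆ₙₐ[ℂ] Matrix ι' ι' ℂ}
    {θ : A →⋆ₙₐ[ℂ] Matrix ι'' ι'' ℂ} (h : UEquiv π ρ) (h' : UEquiv ρ θ) : UEquiv π θ := by
  obtain ⟨u, h1, h2, h3⟩ := h
  obtain ⟨v, k1, k2, k3⟩ := h'
  refine ⟨u * v, ?_, ?_, fun f => ?_⟩
  · rw [Matrix.conjTranspose_mul, Matrix.mul_assoc, ← Matrix.mul_assoc v, k1, Matrix.one_mul, h1]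
  · rw [Matrix.conjTranspose_mul, Matrix.mul_assoc, ← Matrix.mul_assoc _ u, h2, Matrix.one_mul, k2]
  · rw [h3, k3, Matrix.conjTranspose_mul]
    simp only [Matrix.mul_assoc]

theorem UEquiv.trace_eq {π : A →⋆ₙₐ[ℂ] Matrix ι ι ℂ} {ρ : A →⋆ₙₐ[ℂ] Matrix ι' ι' ℂ}
    (h : UEquiv π ρ) (f : A) : (π f).trace = (ρ f).trace := by
  obtain ⟨u, h1, h2, h3⟩ := h
  rw [h3, Matrix.trace_mul_comm, ← Matrix.mul_assoc, h2, Matrix.one_mul]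

theorem UEquiv.card_eq {π : A →⋆ₙₐ[ℂ] Matrix ι ι ℂ} {ρ : A →⋆ₙₐ[ℂ] Matrix ι' ι' ℂ}
    (h : UEquiv π ρ) : Fintype.card ι = Fintype.card ι' := by
  obtain ⟨u, h1, h2, h3⟩ := h
  have h4 : (u * u.conjTranspose).trace = (u.conjTranspose * u).trace := Matrix.trace_mul_comm _ _
  rw [h1, h2, Matrix.trace_one, Matrix.trace_one] at h4
  exact_mod_cast h4

theorem uEquiv_of_submatrix {π : A →⋆ₙₐ[ℂ] Matrix ι ι ℂ} {ρ : A →⋆ₙₐ[ℂ] Matrix ι' ι' ℂ}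
    (e : ι ≃ ι') (h : ∀ f i j, π f i j = ρ f (e i) (e j)) : UEquiv π ρ := by
  have hc : ((1 : Matrix ι' ι' ℂ).submatrix e id).conjTranspose
      = (1 : Matrix ι' ι' ℂ).submatrix id e := by
    rw [Matrix.conjTranspose_submatrix, Matrix.conjTranspose_one]
  refine ⟨(1 : Matrix ι' ι' ℂ).submatrix e id, ?_, ?_, fun f => ?_⟩
  · rw [hc]
    ext i j
    simp [Matrix.mul_apply, Matrix.one_apply]
  · rw [hc]
    rw [Matrix.submatrix_mul_equiv (1 : Matrix ι' ι' ℂ) 1 id e id]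
    simp
  · rw [hc]
    ext i j
    rw [h]
    simp [Matrix.mul_apply, Matrix.one_apply]

/-- The direct sum of two representations. -/
def dsum (π : A →⋆ₙₐ[ℂ] Matrix ι ι ℂ) (ρ : A →⋆ₙₐ[ℂ] Matrix ι' ι' ℂ) :
    A →⋆ₙₐ[ℂ] Matrix (ι ⊕ ι') (ι ⊕ ι') ℂ where
  toFun f := Matrix.fromBlocks (π f) 0 0 (ρ f)
  map_smul' c f := by simp [Matrix.fromBlocks_smul]
  map_zero' := by simp [Matrix.fromBlocks_zero]
  map_add' f g := by simp [Matrix.fromBlocks_add]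
  map_mul' f g := by simp [Matrix.fromBlocks_multiply]
  map_star' f := by simp [Matrix.star_eq_conjTranspose, Matrix.fromBlocks_conjTranspose, map_star]

theorem dsum_apply (π : A →⋆ₙₐ[ℂ] Matrix ι ι ℂ) (ρ : A →⋆ₙₐ[ℂ] Matrix ι' ι' ℂ) (f : A) :
    dsum π ρ f = Matrix.fromBlocks (π f) 0 0 (ρ f) := rfl

theorem UEquiv.dsum_left {π : A →⋆ₙₐ[ℂ] Matrix ι ι ℂ} {ρ : A →⋆ₙₐ[ℂ] Matrix ι' ι' ℂ}
    (h : UEquiv π ρ) (θ : A →⋆ₙₐ[ℂ] Matrix ι'' ι'' ℂ) : UEquiv (dsum θ π) (dsum θ ρ) := by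
  obtain ⟨u, h1, h2, h3⟩ := h
  refine ⟨Matrix.fromBlocks 1 0 0 u, ?_, ?_, fun f => ?_⟩
  · simp [Matrix.fromBlocks_conjTranspose, Matrix.fromBlocks_multiply, h1]
  · simp [Matrix.fromBlocks_conjTranspose, Matrix.fromBlocks_multiply, h2]
  · simp [dsum_apply, Matrix.fromBlocks_conjTranspose, Matrix.fromBlocks_multiply, h3]

/-- The block diagonal sum of a finite family of representations on the same matrix algebra. -/
def blockRep (q : X → A →⋆ₙₐ[ℂ] Matrix κ κ ℂ) : A →⋆ₙₐ[ℂ] Matrix (κ × X) (κ × X) ℂ where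
  toFun f := Matrix.blockDiagonal fun x => q x f
  map_smul' c f := by simp only [map_smul]; exact Matrix.blockDiagonal_smul c fun x => q x f
  map_zero' := by simp only [map_zero]; exact Matrix.blockDiagonal_zero
  map_add' f g := by simp only [map_add]; exact Matrix.blockDiagonal_add _ _
  map_mul' f g := by simp only [map_mul]; exact Matrix.blockDiagonal_mul _ _
  map_star' f := by
    simp only [map_star]; exact (Matrix.blockDiagonal_conjTranspose _).symm

theorem blockRep_apply (q : X → A →⋆ₙₐ[ℂ] Matrix κ κ ℂ) (f : A) :
    blockRep q f = Matrix.blockDiagonal fun x => q x f := rfl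

/-- The block diagonal embedding of a finite power of a matrix algebra in a corner of a matrix
algebra. -/
def cornerHom (κ X ι : Type) [Fintype κ] [DecidableEq κ] [Fintype X] [DecidableEq X]
    [Fintype ι] [DecidableEq ι] :
    (X → Matrix κ κ ℂ) →⋆ₙₐ[ℂ] Matrix (κ × X ⊕ ι) (κ × X ⊕ ι) ℂ where
  toFun D := Matrix.fromBlocks (Matrix.blockDiagonal D) 0 0 0
  map_smul' c f := by simp [Matrix.fromBlocks_smul, Matrix.blockDiagonal_smul]
  map_zero' := by simp [Matrix.fromBlocks_zero]
  map_add' f g := by simp [Matrix.fromBlocks_add]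
  map_mul' f g := by
    rw [Matrix.fromBlocks_multiply]
    simp [← Matrix.blockDiagonal_mul]
    rfl
  map_star' f := by
    simp [Matrix.star_eq_conjTranspose, Matrix.fromBlocks_conjTranspose,
      Matrix.blockDiagonal_conjTranspose]
    rfl

/-- A `*`-homomorphism of C*-algebras is contractive, and the norm on the finite product is the
supremum norm. -/
theorem norm_corner_le (D : X → Matrix κ κ ℂ) {c : ℝ} (hc : 0 ≤ c) (hD : ∀ x, ‖D x‖ ≤ c) :
    ‖(Matrix.fromBlocks (Matrix.blockDiagonal D) 0 0 0 : Matrix (κ × X ⊕ ι) (κ × X ⊕ ι) ℂ)‖ ≤ c :=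
  (NonUnitalStarAlgHom.norm_apply_le (cornerHom κ X ι) D).trans ((pi_norm_le_iff_of_nonneg hc).2 hD)

theorem norm_dsum_blockRep_sub_le (q q' : X → A →⋆ₙₐ[ℂ] Matrix κ κ ℂ)
    (ρ : A →⋆ₙₐ[ℂ] Matrix ι ι ℂ) (f : A) {c : ℝ} (hc : 0 ≤ c)
    (h : ∀ x, ‖q x f - q' x f‖ ≤ c) :
    ‖dsum (blockRep q) ρ f - dsum (blockRep q') ρ f‖ ≤ c := by
  have : dsum (blockRep q) ρ f - dsum (blockRep q') ρ f
      = Matrix.fromBlocks (Matrix.blockDiagonal fun x => q x f - q' x f) 0 0 0 := by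
    rw [dsum_apply, dsum_apply, blockRep_apply, blockRep_apply]
    ext (i | i) (j | j)
    · exact (congrFun (congrFun (Matrix.blockDiagonal_sub (fun x => q x f) fun x => q' x f) i)
        j).symm
    all_goals simp
  rw [this]
  exact norm_corner_le _ hc h

theorem norm_le_one_of_conjTranspose_mul_self {u : Matrix ι ι' ℂ} (h : u.conjTranspose * u = 1) :
    ‖u‖ ≤ 1 := by
  have h1 := Matrix.l2_opNorm_conjTranspose_mul_self u
  have h2 : ‖(1 : Matrix ι' ι' ℂ)‖ ≤ 1 := by
    by_cases hn : Nonempty ι'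
    · exact (norm_one).le
    · have : (1 : Matrix ι' ι' ℂ) = 0 := by
        ext i; exact (hn ⟨i⟩).elim
      rw [this, norm_zero]; exact zero_le_one
  rw [h] at h1
  nlinarith [norm_nonneg u]

theorem norm_conj_le {u : Matrix ι ι' ℂ} (h1 : u * u.conjTranspose = 1)
    (h2 : u.conjTranspose * u = 1) (M : Matrix ι' ι' ℂ) : ‖u * M * u.conjTranspose‖ ≤ ‖M‖ := by
  have hu := norm_le_one_of_conjTranspose_mul_self h2
  have hu' : ‖u.conjTranspose‖ ≤ 1 := norm_le_one_of_conjTranspose_mul_self (by simpa using h1)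
  calc ‖u * M * u.conjTranspose‖ ≤ ‖u * M‖ * ‖u.conjTranspose‖ := Matrix.l2_opNorm_mul _ _
    _ ≤ ‖u * M‖ * 1 := by gcongr
    _ ≤ ‖u‖ * ‖M‖ * 1 := by gcongr; exact Matrix.l2_opNorm_mul _ _
    _ ≤ 1 * ‖M‖ * 1 := by gcongr
    _ = ‖M‖ := by ring

end UnitaryEquivalence

/-! ### Elements of Razak blocks and the standard representations -/

section RazakElements

variable {n k : ℕ}

/-- A continuous matrix-valued function vanishing at both endpoints, as an element of the Razak
block. -/
def RazakBlock.ofVanishing (F : C(unitInterval, Matrix (Fin k × Fin n) (Fin k × Fin n) ℂ))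
    (h0 : F 0 = 0) (h1 : F 1 = 0) : RazakBlock n k :=
  ⟨F, 0, by rw [h0]; exact Matrix.blockDiagonal_zero.symm, by
    simp only [ite_self]; rw [h1]; exact Matrix.blockDiagonal_zero.symm⟩

/-- The element `t ↦ diag(a, …, a, h t • a)` of the Razak block, where `h 0 = 1` and `h 1 = 0`. -/
noncomputable def RazakBlock.lift (h : C(unitInterval, ℝ)) (h0 : h 0 = 1) (h1 : h 1 = 0)
    (a : Matrix (Fin k) (Fin k) ℂ) : RazakBlock n k :=
  ⟨⟨fun t => Matrix.blockDiagonal fun i : Fin n => if (i : ℕ) + 1 < n then a else (h t : ℂ) • a, by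
      refine Continuous.matrix_blockDiagonal (continuous_pi fun i => ?_)
      split_ifs
      · exact continuous_const
      · exact (Complex.continuous_ofReal.comp h.continuous).smul continuous_const⟩, a,
    by simp [h0], by simp [h1]⟩

theorem RazakBlock.lift_apply (h : C(unitInterval, ℝ)) (h0 : h 0 = 1) (h1 : h 1 = 0)
    (a : Matrix (Fin k) (Fin k) ℂ) (t : unitInterval) : (lift (n := n) h h0 h1 a).1 t =
      Matrix.blockDiagonal fun i : Fin n => if (i : ℕ) + 1 < n then a else (h t : ℂ) • a := rfl

theorem RazakBlock.inftyRep_lift [NeZero n] (h : C(unitInterval, ℝ)) (h0 : h 0 = 1) (h1 : h 1 = 0)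
    (a : Matrix (Fin k) (Fin k) ℂ) : inftyRep (lift (n := n) h h0 h1 a) = a := by
  change Matrix.blockDiag ((lift (n := n) h h0 h1 a).1 0) 0 = a
  rw [lift_apply, Matrix.blockDiag_blockDiagonal]
  simp [h0]

theorem RazakBlock.apply_zero [NeZero n] (f : RazakBlock n k) :
    f.1 0 = Matrix.blockDiagonal (fun _ : Fin n => inftyRep f) := razakBlock_apply_zero f

theorem RazakBlock.apply_one [NeZero n] (f : RazakBlock n k) : f.1 1 =
    Matrix.blockDiagonal (fun i : Fin n => if (i : ℕ) + 1 < n then inftyRep f else 0) := by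
  obtain ⟨a, h0, h1⟩ := f.2
  have : inftyRep f = a := by
    change Matrix.blockDiag (f.1 0) 0 = a
    rw [h0, Matrix.blockDiag_blockDiagonal]
  rw [h1, this]

theorem RazakBlock.ext_apply {f g : RazakBlock n k} (h : ∀ t, f.1 t = g.1 t) : f = g :=
  Subtype.ext (ContinuousMap.ext h)

theorem RazakBlock.trace_apply_zero [NeZero n] (f : RazakBlock n k) :
    (f.1 0).trace = n * (inftyRep f).trace := by
  rw [apply_zero, Matrix.trace_blockDiagonal]
  simp

theorem RazakBlock.trace_apply_one [NeZero n] (f : RazakBlock n k) :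
    (f.1 1).trace = (n - 1) * (inftyRep f).trace := by
  rw [apply_one, Matrix.trace_blockDiagonal]
  obtain ⟨m, rfl⟩ : ∃ m, n = m + 1 := Nat.exists_eq_succ_of_ne_zero (NeZero.ne n)
  rw [Fin.sum_univ_castSucc]
  simp

/-- The representation of a Razak block that is the direct sum of the evaluations at the points
`s x`, of copies of the representation at infinity indexed by `Y`, and of a zero representation of
dimension the size of `Z`. -/
noncomputable def stdRep [NeZero n] {X : Type} [Fintype X] [DecidableEq X] (s : X → unitInterval)
    (Y Z : Type) [Fintype Y] [DecidableEq Y] [Fintype Z] [DecidableEq Z] :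
    RazakBlock n k →⋆ₙₐ[ℂ] Matrix (((Fin k × Fin n) × X) ⊕ ((Fin k × Y) ⊕ Z))
      (((Fin k × Fin n) × X) ⊕ ((Fin k × Y) ⊕ Z)) ℂ :=
  dsum (blockRep fun x => pointRep (s x)) (dsum (blockRep fun _ : Y => inftyRep)
    (0 : RazakBlock n k →⋆ₙₐ[ℂ] Matrix Z Z ℂ))

theorem trace_stdRep [NeZero n] {X : Type} [Fintype X] [DecidableEq X] (s : X → unitInterval)
    (Y Z : Type) [Fintype Y] [DecidableEq Y] [Fintype Z] [DecidableEq Z] (f : RazakBlock n k) :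
    (stdRep s Y Z f).trace = ∑ x, (f.1 (s x)).trace + Fintype.card Y * (inftyRep f).trace := by
  have hb : ∀ {ι ι' : Type} [Fintype ι] [Fintype ι'] (M : Matrix ι ι ℂ) (N : Matrix ι' ι' ℂ),
      (Matrix.fromBlocks M 0 0 N).trace = M.trace + N.trace := fun M N => by
    simp [Matrix.trace, Fintype.sum_sum_type]
  rw [stdRep, dsum_apply, dsum_apply, hb, hb, blockRep_apply, blockRep_apply,
    Matrix.trace_blockDiagonal, Matrix.trace_blockDiagonal]
  simp
  rfl

theorem stdRep_congr [NeZero n] {X X' : Type} [Fintype X] [DecidableEq X] [Fintype X']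
    [DecidableEq X'] {s : X → unitInterval} {s' : X' → unitInterval}
    {Y Z Y' Z' : Type} [Fintype Y] [DecidableEq Y] [Fintype Z] [DecidableEq Z]
    [Fintype Y'] [DecidableEq Y'] [Fintype Z'] [DecidableEq Z']
    (e : X ≃ X') (he : ∀ x, s' (e x) = s x) (eY : Y ≃ Y') (eZ : Z ≃ Z') :
    UEquiv (stdRep (n := n) (k := k) s Y Z) (stdRep s' Y' Z') := by
  refine uEquiv_of_submatrix (Equiv.sumCongr (Equiv.prodCongr (Equiv.refl _) e)
    (Equiv.sumCongr (Equiv.prodCongr (Equiv.refl _) eY) eZ)) fun f i j => ?_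
  rcases i with ⟨i, x⟩ | ⟨i, y⟩ | z <;> rcases j with ⟨j, x'⟩ | ⟨j, y'⟩ | z' <;>
    simp [stdRep, dsum_apply, blockRep_apply, Matrix.blockDiagonal_apply, he]

end RazakElements

/-! ### Splitting off subrepresentations -/

section Subrepresentations

open Matrix

variable {A : Type*} [NonUnitalCStarAlgebra A]
variable {ι κ : Type} [Fintype ι] [DecidableEq ι] [Fintype κ] [DecidableEq κ]

/-- A vector state of `π` that is a diagonal matrix coefficient of a surjective representation `q`
gives an isometry intertwining `q` with `π`. -/
theorem exists_isometry_of_vectorState {π : A →⋆ₙₐ[ℂ] Matrix ι ι ℂ} {q : A →⋆ₙₐ[ℂ] Matrix κ κ ℂ}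
    (hq : Function.Surjective q) (i₀ : κ) (ξ : ι → ℂ)
    (h : ∀ f, star ξ ⬝ᵥ (π f *ᵥ ξ) = q f i₀ i₀) :
    ∃ W : Matrix ι κ ℂ, W.conjTranspose * W = 1 ∧ ∀ f, π f * W = W * q f := by
  have key : ∀ y z, star (π y *ᵥ ξ) ⬝ᵥ (π z *ᵥ ξ) = q (star y * z) i₀ i₀ := fun y z => by
    rw [← h, map_mul, map_star, Matrix.star_mulVec, ← Matrix.dotProduct_mulVec,
      Matrix.mulVec_mulVec, Matrix.star_eq_conjTranspose]
  -- As in the GNS construction, lifts of the matrix units $e_{i i_0}$ applied to ξ give an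
  -- orthonormal family, which forms the columns of the isometry.
  choose x hx using fun i : κ => hq (Matrix.single i i₀ (1 : ℂ))
  refine ⟨Matrix.of fun a i => (π (x i) *ᵥ ξ) a, ?_, fun f => ?_⟩
  · ext i j
    have h1 := key (x i) (x j)
    rw [map_mul, map_star, hx, hx, Matrix.star_eq_conjTranspose, Matrix.conjTranspose_single] at h1
    refine (h1 : _ = _).trans ?_
    rw [Matrix.one_apply]
    split_ifs with hij
    · subst hij
      simp
    · simp [hij]
  · have hy : ∀ j, π (f * x j) *ᵥ ξ = ∑ i, q f i j • (π (x i) *ᵥ ξ) := fun j => by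
      -- The error y lies in the kernel of q, so `key` gives $\|\pi(y)\xi\|^2 = q(y^*y)_{i_0i_0} =
      -- 0$.
      set y := f * x j - ∑ i, q f i j • x i with hy
      have hqy : q y = 0 := by
        rw [hy, map_sub, map_mul, map_sum, sub_eq_zero]
        simp only [map_smul, hx]
        ext a b
        simp only [Matrix.sum_apply, Matrix.smul_apply, Matrix.mul_apply, Matrix.single_apply]
        by_cases hb : i₀ = b <;> simp [hb]
      have h2 := key y y
      rw [map_mul, hqy, mul_zero, Matrix.zero_apply] at h2
      have h3 : π y *ᵥ ξ = 0 := dotProduct_star_self_eq_zero.1 h2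
      rw [hy, map_sub, Matrix.sub_mulVec, sub_eq_zero] at h3
      rw [h3, map_sum, Matrix.sum_mulVec]
      simp only [map_smul, Matrix.smul_mulVec]
    ext a j
    have h4 := congrFun (hy j) a
    rw [map_mul, ← Matrix.mulVec_mulVec, Finset.sum_apply] at h4
    refine (h4 : _ = _).trans ?_
    simp [Matrix.mul_apply, mul_comm]

/-- The columns of W are orthonormal and extend to an orthonormal basis; the added vectors are the
columns of V. -/
theorem exists_unitary_extension (W : Matrix ι κ ℂ) (hW : W.conjTranspose * W = 1) :
    ∃ (c : ℕ) (V : Matrix ι (Fin c) ℂ), W.conjTranspose * V = 0 ∧ V.conjTranspose * V = 1 ∧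
      W * W.conjTranspose + V * V.conjTranspose = 1 := by
  have horth : Orthonormal ℂ fun j : κ => (WithLp.toLp 2 fun i => W i j : EuclideanSpace ℂ ι) := by
    rw [orthonormal_iff_ite]
    intro i j
    rw [EuclideanSpace.inner_eq_star_dotProduct, dotProduct_comm, ← Matrix.one_apply, ← hW]
    rfl
  have hcard : Fintype.card κ ≤ Fintype.card ι := by
    simpa using horth.linearIndependent.fintype_card_le_finrank
  let c := Fintype.card ι - Fintype.card κ
  have hc : Module.finrank ℂ (EuclideanSpace ℂ ι) = Fintype.card (κ ⊕ Fin c) := by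
    simp [c]; omega
  let v : κ ⊕ Fin c → EuclideanSpace ℂ ι :=
    Sum.elim (fun j : κ => (WithLp.toLp 2 fun i => W i j : EuclideanSpace ℂ ι)) 0
  have hv : Orthonormal ℂ ((Set.range (Sum.inl : κ → κ ⊕ Fin c)).domRestrict v) := by
    rw [orthonormal_iff_ite] at horth ⊢
    rintro ⟨_, i, rfl⟩ ⟨_, j, rfl⟩
    simpa [v, Set.domRestrict, Subtype.ext_iff] using horth i j
  obtain ⟨b, hb⟩ := hv.exists_orthonormalBasis_extension_of_card_eq hc
  let U : Matrix ι (κ ⊕ Fin c) ℂ := Matrix.of fun i j => b j i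
  have hU : U.conjTranspose * U = 1 := by
    ext i j
    have h1 := (orthonormal_iff_ite.1 b.orthonormal) i j
    rw [EuclideanSpace.inner_eq_star_dotProduct, dotProduct_comm, ← Matrix.one_apply] at h1
    rw [← h1]
    rfl
  have hU' : U * U.conjTranspose = 1 := by
    refine (Matrix.mul_eq_one_comm_of_card_eq _ _ _ ?_).1 hU
    rw [← hc]; simp
  have hUW : U = Matrix.fromCols W (U.toCols₂) := by
    ext i (j | j)
    · simp [U, hb (Sum.inl j) ⟨j, rfl⟩, v]
    · simp
  refine ⟨c, U.toCols₂, ?_, ?_, ?_⟩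
  · rw [hUW, Matrix.conjTranspose_fromCols_eq_fromRows_conjTranspose,
      Matrix.fromRows_mul_fromCols] at hU
    have := congrArg Matrix.toBlocks₁₂ hU
    simpa [← Matrix.fromBlocks_one] using this
  · rw [hUW, Matrix.conjTranspose_fromCols_eq_fromRows_conjTranspose,
      Matrix.fromRows_mul_fromCols] at hU
    have := congrArg Matrix.toBlocks₂₂ hU
    simpa [← Matrix.fromBlocks_one] using this
  · rw [hUW, Matrix.conjTranspose_fromCols_eq_fromRows_conjTranspose,
      Matrix.fromCols_mul_fromRows] at hU'
    exact hU'

/-- The range of W is invariant under π. Since π preserves adjoints, the orthogonal complement is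
invariant as well, and π' is the compression to it. -/
theorem exists_uEquiv_dsum {π : A →⋆ₙₐ[ℂ] Matrix ι ι ℂ} {q : A →⋆ₙₐ[ℂ] Matrix κ κ ℂ}
    (W : Matrix ι κ ℂ) (hW : W.conjTranspose * W = 1) (h : ∀ f, π f * W = W * q f) :
    ∃ (c : ℕ) (π' : A →⋆ₙₐ[ℂ] Matrix (Fin c) (Fin c) ℂ), UEquiv π (dsum q π') := by
  obtain ⟨c, V, hWV, hV, hVV⟩ := exists_unitary_extension W hW
  have hVW : V.conjTranspose * W = 0 := by
    have := congrArg Matrix.conjTranspose hWV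
    simpa using this
  have h' : ∀ f, W.conjTranspose * π f = q f * W.conjTranspose := fun f => by
    have := congrArg Matrix.conjTranspose (h (star f))
    simpa [map_star, Matrix.star_eq_conjTranspose] using this
  have hP : V * V.conjTranspose = 1 - W * W.conjTranspose := by rw [← hVV]; abel
  have hcomm : ∀ f, V * V.conjTranspose * π f = π f * (V * V.conjTranspose) := fun f => by
    rw [hP, Matrix.sub_mul, Matrix.mul_sub, Matrix.mul_assoc, h', ← Matrix.mul_assoc, ← h,
      Matrix.mul_assoc]
    simp
  let π' : A →⋆ₙₐ[ℂ] Matrix (Fin c) (Fin c) ℂ :=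
    { toFun := fun f => V.conjTranspose * π f * V
      map_smul' := fun r f => by simp
      map_zero' := by simp
      map_add' := fun f g => by simp [Matrix.mul_add, Matrix.add_mul]
      map_mul' := fun f g => by
        rw [map_mul]
        calc V.conjTranspose * (π f * π g) * V
            = V.conjTranspose * V * V.conjTranspose * π f * π g * V := by
              rw [hV, Matrix.one_mul]; simp only [Matrix.mul_assoc]
          _ = V.conjTranspose * (V * V.conjTranspose * π f) * π g * V := by
              simp only [Matrix.mul_assoc]
          _ = _ := by rw [hcomm]; simp only [Matrix.mul_assoc]
      map_star' := fun f => by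
        simp [map_star, Matrix.star_eq_conjTranspose, Matrix.mul_assoc] }
  have hπ' : ∀ f, π' f = V.conjTranspose * π f * V := fun f => rfl
  refine ⟨c, π', Matrix.fromCols W V, ?_, ?_, fun f => ?_⟩
  · rw [Matrix.conjTranspose_fromCols_eq_fromRows_conjTranspose, Matrix.fromCols_mul_fromRows, hVV]
  · rw [Matrix.conjTranspose_fromCols_eq_fromRows_conjTranspose, Matrix.fromRows_mul_fromCols,
      hW, hWV, hVW, hV, Matrix.fromBlocks_one]
  · rw [dsum_apply, Matrix.conjTranspose_fromCols_eq_fromRows_conjTranspose,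
      Matrix.fromCols_mul_fromBlocks, Matrix.fromCols_mul_fromRows]
    simp only [Matrix.mul_zero, zero_add, add_zero]
    have h1 : V * π' f * V.conjTranspose = π f * (V * V.conjTranspose) := by
      calc V * π' f * V.conjTranspose = (V * V.conjTranspose * π f) * (V * V.conjTranspose) := by
            rw [hπ']; simp only [Matrix.mul_assoc]
        _ = π f * (V * (V.conjTranspose * V) * V.conjTranspose) := by
            rw [hcomm]; simp only [Matrix.mul_assoc]
        _ = π f * (V * V.conjTranspose) := by rw [hV, Matrix.mul_one]
    rw [h1, ← h, Matrix.mul_assoc, ← Matrix.mul_add, hVV, Matrix.mul_one]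

/-- Commuting Hermitian matrices have joint eigenspaces that span. If the eigenvalue at j₁ were 0 on
every joint eigenspace, then `T j₁` would vanish. -/
theorem exists_joint_eigenvector {J : Type*} (T : J → Matrix ι ι ℂ) (hT : ∀ j, (T j).IsHermitian)
    (hc : ∀ i j, Commute (T i) (T j)) (j₁ : J) (hj : T j₁ ≠ 0) :
    ∃ (ξ : ι → ℂ) (χ : J → ℝ), star ξ ⬝ᵥ ξ = 1 ∧ (∀ j, T j *ᵥ ξ = (χ j : ℂ) • ξ) ∧ χ j₁ ≠ 0 := by
  let L : J → EuclideanSpace ℂ ι →ₗ[ℂ] EuclideanSpace ℂ ι := fun j => Matrix.toEuclideanLin (T j)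
  have hL : ∀ j, (L j).IsSymmetric := fun j => Matrix.isSymmetric_toEuclideanLin_iff.2 (hT j)
  have h1 : ⨆ χ : J → ℂ, ⨅ j, Module.End.eigenspace (L j) (χ j) = ⊤ :=
    LinearMap.IsSymmetric.iSup_iInf_eq_top_of_commute hL fun i j _ => by
        have h2 := (hc i j).eq
        refine LinearMap.ext fun x => ?_
        apply (WithLp.linearEquiv 2 ℂ (ι → ℂ)).injective
        simp [L, Module.End.mul_apply, h2]
  by_contra! hcon
  refine hj ?_
  have h3 : ⨆ χ : J → ℂ, ⨅ j, Module.End.eigenspace (L j) (χ j) ≤ LinearMap.ker (L j₁) := by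
    refine iSup_le fun χ x hx => ?_
    rw [Submodule.mem_iInf] at hx
    by_cases hx0 : x = 0
    · rw [hx0]; exact Submodule.zero_mem _
    · have h4 : ∀ j, L j x = χ j • x := fun j => Module.End.mem_eigenspace_iff.1 (hx j)
      have hre : ∀ j, ((χ j).re : ℂ) = χ j := fun j => Complex.conj_eq_iff_re.1
        ((hL j).conj_eigenvalue_eq_self
          (Module.End.hasEigenvalue_of_hasEigenvector (x := x) ⟨hx j, hx0⟩))
      have hn : (‖x‖ : ℂ) ≠ 0 := by simpa using hx0
      have h5 := hcon ((‖x‖ : ℂ)⁻¹ • x.ofLp) (fun j => (χ j).re) (by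
        have h6 : star x.ofLp ⬝ᵥ x.ofLp = (‖x‖ : ℂ) ^ 2 := by
          rw [dotProduct_comm, ← EuclideanSpace.inner_eq_star_dotProduct, inner_self_eq_norm_sq_to_K]
          rfl
        rw [star_smul, smul_dotProduct, dotProduct_smul, h6]
        simp
        field_simp) fun j => by
        have := congrArg WithLp.ofLp (h4 j)
        rw [hre, Matrix.mulVec_smul, smul_comm]
        congr 1
      rw [LinearMap.mem_ker, h4, ← hre, h5, Complex.ofReal_zero, zero_smul]
  rw [h1, top_le_iff, LinearMap.ker_eq_top] at h3
  exact (LinearEquiv.map_eq_zero_iff _).1 h3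

end Subrepresentations

/-! ### Finding a point evaluation or the representation at infinity -/

section Irreducible

open Matrix

variable {n k : ℕ}

theorem exists_bump (S : Set unitInterval) (hS : S.Finite) (t : unitInterval) (ht : t ∉ S) :
    ∃ h : C(unitInterval, ℝ), h t = 1 ∧ ∀ s ∈ S, h s = 0 := by
  obtain ⟨h, h0, h1, -⟩ := exists_continuous_zero_one_of_isClosed hS.isClosed
    (isClosed_singleton (x := t)) (by simpa using ht)
  exact ⟨h, h1 rfl, fun s hs => h0 hs⟩

theorem exists_bump_vanishing (t : unitInterval) (h0 : 0 < t) (h1 : t < 1) :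
    ∃ h : C(unitInterval, ℝ), h t = 1 ∧ h 0 = 0 ∧ h 1 = 0 := by
  obtain ⟨h, ht, hS⟩ := exists_bump {0, 1} (Set.toFinite _) t (by
    rintro (h | h)
    · exact h0.ne' h
    · exact h1.ne h)
  exact ⟨h, ht, hS _ (by simp), hS _ (by simp)⟩

/-- The element `t ↦ h t • M` of the Razak block, for a real function `h` vanishing at both
endpoints. -/
noncomputable def RazakBlock.bump (h : C(unitInterval, ℝ)) (h0 : h 0 = 0) (h1 : h 1 = 0)
    (M : Matrix (Fin k × Fin n) (Fin k × Fin n) ℂ) : RazakBlock n k :=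
  ofVanishing ⟨fun t => (h t : ℂ) • M, by fun_prop⟩ (by simp [h0]) (by simp [h1])

theorem RazakBlock.bump_apply (h : C(unitInterval, ℝ)) (h0 : h 0 = 0) (h1 : h 1 = 0)
    (M : Matrix (Fin k × Fin n) (Fin k × Fin n) ℂ) (t : unitInterval) :
    (bump h h0 h1 M).1 t = (h t : ℂ) • M := rfl

theorem surjective_pointRep {t : unitInterval} (h0 : 0 < t) (h1 : t < 1) :
    Function.Surjective (pointRep (n := n) (k := k) t) := fun M => by
  obtain ⟨h, ht, hh0, hh1⟩ := exists_bump_vanishing t h0 h1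
  refine ⟨RazakBlock.bump h hh0 hh1 M, ?_⟩
  change (h t : ℂ) • M = M
  simp [ht]

/-- The function `t ↦ 1 - t` on the unit interval. -/
def symmCoe : C(unitInterval, ℝ) := ⟨fun t => 1 - t, by fun_prop⟩

theorem surjective_inftyRep [NeZero n] : Function.Surjective (inftyRep (n := n) (k := k)) :=
  fun a => ⟨RazakBlock.lift symmCoe (by simp [symmCoe]) (by simp [symmCoe]) a,
    RazakBlock.inftyRep_lift _ _ _ _⟩

/-- A nonzero real multiplicative functional on the functions vanishing at the endpoints is the
evaluation at an interior point. -/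
theorem exists_eq_eval_of_multiplicative
    (χ : {h : C(unitInterval, ℝ) // h 0 = 0 ∧ h 1 = 0} → ℝ)
    (hadd : ∀ f g h, h.1 = f.1 + g.1 → χ h = χ f + χ g)
    (hsmul : ∀ (c : ℝ) f h, h.1 = c • f.1 → χ h = c * χ f)
    (hmul : ∀ f g h, h.1 = f.1 * g.1 → χ h = χ f * χ g)
    (h₁ : {h : C(unitInterval, ℝ) // h 0 = 0 ∧ h 1 = 0}) (hh₁ : χ h₁ ≠ 0) :
    ∃ t : unitInterval, 0 < t ∧ t < 1 ∧ ∀ h, χ h = h.1 t := by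
  let m : C(unitInterval, ℝ) → {h : C(unitInterval, ℝ) // h 0 = 0 ∧ h 1 = 0} := fun p =>
    ⟨p * h₁.1, by simp [h₁.2.1], by simp [h₁.2.2]⟩
  -- Multiplying by h₁ and normalising extends χ to a unital character of all of C[0,1].
  let X : C(unitInterval, ℝ) → ℝ := fun p => χ (m p) / χ h₁
  have hXmul : ∀ p q, X (p * q) = X p * X q := fun p q => by
    let r : {h : C(unitInterval, ℝ) // h 0 = 0 ∧ h 1 = 0} := ⟨p * h₁.1 * (q * h₁.1), by
      simp [h₁.2.1], by simp [h₁.2.2]⟩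
    have e1 := hmul (m (p * q)) h₁ r (by simp only [r, m]; ring)
    have e2 := hmul (m p) (m q) r rfl
    simp only [X]
    rw [div_mul_div_comm, ← e2, e1]
    field_simp
  have hXadd : ∀ p q, X (p + q) = X p + X q := fun p q => by
    simp only [X]
    rw [hadd (m p) (m q) (m (p + q)) (by simp only [m]; ring), add_div]
  have hX1 : X 1 = 1 := by
    have : m 1 = h₁ := Subtype.ext (by simp [m])
    simp only [X]
    rw [this, div_self hh₁]
  have hXsmul : ∀ c : ℝ, X (ContinuousMap.C c) = c := fun c => by
    simp only [X]
    rw [hsmul c h₁ (m (ContinuousMap.C c)) (by ext; simp [m]), mul_div_cancel_right₀ _ hh₁]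
  have hX0 : X 0 = 0 := by
    have := hXsmul 0
    rwa [map_zero] at this
  let Y : C(unitInterval, ℝ) →+* ℝ :=
    { toFun := X, map_one' := hX1, map_mul' := hXmul, map_zero' := hX0, map_add' := hXadd }
  have hYC : ∀ c : ℝ, Y (ContinuousMap.C c) = c := hXsmul
  let I : C(unitInterval, ℝ) := ⟨fun t => (t : ℝ), by fun_prop⟩
  have hval : ∀ g : C(unitInterval, ℝ), ∃ t : unitInterval, (t : ℝ) = Y I ∧ g t = Y g := by
    intro g
    by_contra! hcon
    -- If no point takes both prescribed values, this sum of squares is invertible, yet the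
    -- character kills it. Pairing every g with the coordinate function I forces the same point for
    -- all g.
    let p : C(unitInterval, ℝ) := (I - ContinuousMap.C (Y I)) ^ 2 + (g - ContinuousMap.C (Y g)) ^ 2
    have hp : ∀ x, p x ≠ 0 := fun x hx => by
      have hx' : ((x : ℝ) - Y I) ^ 2 + (g x - Y g) ^ 2 = 0 := hx
      refine hcon x ?_ ?_
      · nlinarith [sq_nonneg ((x : ℝ) - Y I), sq_nonneg (g x - Y g)]
      · nlinarith [sq_nonneg ((x : ℝ) - Y I), sq_nonneg (g x - Y g)]
    have hYp : Y p = 0 := by simp [p, hYC]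
    let r : C(unitInterval, ℝ) := ⟨fun x => (p x)⁻¹, p.continuous.inv₀ hp⟩
    have hpr : p * r = 1 := by
      ext x
      exact mul_inv_cancel₀ (hp x)
    have h1 := congrArg Y hpr
    rw [map_mul, hYp, zero_mul, map_one] at h1
    exact zero_ne_one h1
  obtain ⟨t, ht, -⟩ := hval 0
  have hY : ∀ g, Y g = g t := fun g => by
    obtain ⟨s, hs, hg⟩ := hval g
    rw [← hg, Subtype.ext (hs.trans ht.symm)]
  have hχ : ∀ h, χ h = h.1 t := fun h => by
    rw [← hY]
    change χ h = χ (m h.1) / χ h₁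
    rw [hmul h h₁ (m h.1) rfl, mul_div_cancel_right₀ _ hh₁]
  rw [hχ] at hh₁
  refine ⟨t, ?_, ?_, hχ⟩
  · exact bot_lt_iff_ne_bot.2 fun h => hh₁ (by rw [show t = 0 from h]; exact h₁.2.1)
  · exact lt_top_iff_ne_top.2 fun h => hh₁ (by rw [show t = 1 from h]; exact h₁.2.2)

/-- A representation that does not vanish on the functions vanishing at the endpoints contains
the evaluation at an interior point. -/
theorem exists_isometry_pointRep [NeZero n] [NeZero k] {ι : Type} [Fintype ι] [DecidableEq ι]
    (π : RazakBlock n k →⋆ₙₐ[ℂ] Matrix ι ι ℂ) (i₀ : Fin k × Fin n) (h : C(unitInterval, ℝ))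
    (h0 : h 0 = 0) (h1 : h 1 = 0) (hπ : π (RazakBlock.bump h h0 h1 (single i₀ i₀ 1)) ≠ 0) :
    ∃ t : unitInterval, 0 < t ∧ t < 1 ∧ ∃ W : Matrix ι (Fin k × Fin n) ℂ,
      W.conjTranspose * W = 1 ∧ ∀ f, π f * W = W * pointRep t f := by
  let e : {h : C(unitInterval, ℝ) // h 0 = 0 ∧ h 1 = 0} → RazakBlock n k := fun h =>
    RazakBlock.bump h.1 h.2.1 h.2.2 (single i₀ i₀ 1)
  have hemul : ∀ f g h, h.1 = f.1 * g.1 → e h = e f * e g := fun f g h hfg => by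
    refine RazakBlock.ext_apply fun t => ?_
    change (h.1 t : ℂ) • single i₀ i₀ (1 : ℂ) =
      ((f.1 t : ℂ) • single i₀ i₀ (1 : ℂ)) * ((g.1 t : ℂ) • single i₀ i₀ (1 : ℂ))
    rw [hfg]
    simp
  have hstar : ∀ f, star (e f) = e f := fun f => by
    refine RazakBlock.ext_apply fun t => ?_
    change star ((f.1 t : ℂ) • single i₀ i₀ (1 : ℂ)) = (f.1 t : ℂ) • single i₀ i₀ (1 : ℂ)
    simp [Matrix.star_eq_conjTranspose]
  -- The elements $h\,e_{i_0i_0}$ form a commuting self-adjoint family. Their joint eigenvalues are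
  -- multiplicative in h, hence given by evaluation at an interior point t.
  obtain ⟨ξ, χ, hξ, hχ, hχ1⟩ := exists_joint_eigenvector (fun j => π (e j))
    (fun j => by
      rw [Matrix.IsHermitian, ← Matrix.star_eq_conjTranspose, ← map_star, hstar])
    (fun i j => by
      rw [Commute, SemiconjBy, ← map_mul, ← map_mul,
        ← hemul i j ⟨i.1 * j.1, by simp [i.2.1], by simp [i.2.2]⟩ rfl,
        ← hemul j i ⟨i.1 * j.1, by simp [i.2.1], by simp [i.2.2]⟩ (mul_comm _ _)]) ⟨h, h0, h1⟩ hπ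
  have hχeq : ∀ (h : {h : C(unitInterval, ℝ) // h 0 = 0 ∧ h 1 = 0}) (c : ℝ),
      π (e h) *ᵥ ξ = (c : ℂ) • ξ → χ h = c := fun h c hc => by
    rw [hχ] at hc
    have := congrArg (fun v => star ξ ⬝ᵥ v) hc
    simp only [dotProduct_smul, hξ, smul_eq_mul, mul_one] at this
    exact_mod_cast this
  obtain ⟨t, ht0, ht1, ht⟩ := exists_eq_eval_of_multiplicative χ (fun f g h hfg => by
      refine hχeq _ _ ?_
      have : e h = e f + e g := RazakBlock.ext_apply fun t => by
        change (h.1 t : ℂ) • single i₀ i₀ (1 : ℂ) =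
          (f.1 t : ℂ) • single i₀ i₀ (1 : ℂ) + (g.1 t : ℂ) • single i₀ i₀ (1 : ℂ)
        rw [hfg, ← add_smul]
        simp
      rw [this, map_add, Matrix.add_mulVec, hχ, hχ, ← add_smul, Complex.ofReal_add])
    (fun c f h hf => by
      refine hχeq _ _ ?_
      have : e h = (c : ℂ) • e f := RazakBlock.ext_apply fun t => by
        change (h.1 t : ℂ) • single i₀ i₀ (1 : ℂ) = (c : ℂ) • (f.1 t : ℂ) • single i₀ i₀ (1 : ℂ)
        rw [hf, smul_smul]
        simp
      rw [this, map_smul, Matrix.smul_mulVec, hχ, smul_smul, Complex.ofReal_mul])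
    (fun f g h hfg => by
      refine hχeq _ _ ?_
      rw [hemul f g h hfg, map_mul, ← Matrix.mulVec_mulVec, hχ, Matrix.mulVec_smul, hχ, smul_smul,
        Complex.ofReal_mul, mul_comm]) _ hχ1
  refine ⟨t, ht0, ht1, exists_isometry_of_vectorState (surjective_pointRep ht0 ht1) i₀ ξ
    fun f => ?_⟩
  obtain ⟨g, hg, hg0, hg1⟩ := exists_bump_vanishing t ht0 ht1
  let g' : {h : C(unitInterval, ℝ) // h 0 = 0 ∧ h 1 = 0} := ⟨g, hg0, hg1⟩
  let a : {h : C(unitInterval, ℝ) // h 0 = 0 ∧ h 1 = 0} :=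
    ⟨⟨fun s => g s ^ 2 * (f.1 s i₀ i₀).re, by fun_prop⟩, by simp [hg0], by simp [hg1]⟩
  let b : {h : C(unitInterval, ℝ) // h 0 = 0 ∧ h 1 = 0} :=
    ⟨⟨fun s => g s ^ 2 * (f.1 s i₀ i₀).im, by fun_prop⟩, by simp [hg0], by simp [hg1]⟩
  have hfix : π (e g') *ᵥ ξ = ξ := by rw [hχ, ht, hg]; simp
  -- With $g(t)=1$, compressing f by $g\,e_{i_0i_0}$ does not change the vector state at ξ and
  -- leaves a combination of elements whose eigenvalues at ξ are known.
  have hcut : e g' * f * e g' = e a + Complex.I • e b := RazakBlock.ext_apply fun s => by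
    change ((g s : ℂ) • single i₀ i₀ (1 : ℂ)) * f.1 s * ((g s : ℂ) • single i₀ i₀ (1 : ℂ)) =
      (((g s ^ 2 * (f.1 s i₀ i₀).re : ℝ) : ℂ) • single i₀ i₀ (1 : ℂ)) +
        Complex.I • (((g s ^ 2 * (f.1 s i₀ i₀).im : ℝ) : ℂ) • single i₀ i₀ (1 : ℂ))
    rw [Matrix.smul_mul, Matrix.mul_smul, Matrix.smul_mul, Matrix.single_mul_mul_single, smul_smul,
      smul_smul, ← add_smul]
    rw [Matrix.smul_single, Matrix.smul_single]
    congr 1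
    have h3 := Complex.re_add_im (f.1 s i₀ i₀)
    simp only [smul_eq_mul, Complex.ofReal_mul, Complex.ofReal_pow, mul_one, one_mul]
    linear_combination -(g s : ℂ) ^ 2 * h3
  have h2 : star ξ ⬝ᵥ (π f *ᵥ ξ) = star ξ ⬝ᵥ (π (e g' * f * e g') *ᵥ ξ) := by
    have h3 : star ξ = star ξ ᵥ* π (e g') := by
      conv_lhs => rw [← hfix]
      rw [Matrix.star_mulVec, ← Matrix.star_eq_conjTranspose, ← map_star, hstar]
    rw [map_mul, map_mul, ← Matrix.mulVec_mulVec, hfix, ← Matrix.mulVec_mulVec,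
      Matrix.dotProduct_mulVec _ (π (e g')), ← h3]
  rw [h2, hcut, map_add, map_smul, Matrix.add_mulVec, Matrix.smul_mulVec, hχ, hχ, ht, ht,
    dotProduct_add, dotProduct_smul, dotProduct_smul, dotProduct_smul, hξ]
  change _ = f.1 t i₀ i₀
  conv_rhs => rw [← Complex.re_add_im (f.1 t i₀ i₀)]
  simp [a, b, hg, mul_comm]

/-- If a representation vanishes on all `bump h (single i₀ i₀ 1)`, then it factors through the
representation at infinity. -/
theorem map_eq_zero_of_bump_eq_zero [NeZero n] {ι : Type} [Fintype ι] [DecidableEq ι]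
    (π : RazakBlock n k →⋆ₙₐ[ℂ] Matrix ι ι ℂ) (i₀ : Fin k × Fin n)
    (hπ : ∀ (h : C(unitInterval, ℝ)) (h0 : h 0 = 0) (h1 : h 1 = 0),
      π (RazakBlock.bump h h0 h1 (single i₀ i₀ 1)) = 0)
    (f : RazakBlock n k) (hf : inftyRep f = 0) : π f = 0 := by
  -- The vanishing spreads from the one diagonal entry by $x = 0 \iff xx^* = 0$ along the row $i_0$,
  -- and then by $x = 0 \iff x^*x = 0$ to all matrix entries.
  have hb1 : ∀ (h : C(unitInterval, ℝ)) (h0 : h 0 = 0) (h1 : h 1 = 0) (j : Fin k × Fin n),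
      π (RazakBlock.bump h h0 h1 (single i₀ j 1)) = 0 := fun h h0 h1 j => by
    rw [← Matrix.self_mul_conjTranspose_eq_zero, ← Matrix.star_eq_conjTranspose, ← map_star,
      ← map_mul, ← hπ (h * h) (by simp [h0]) (by simp [h1])]
    congr 1
    refine RazakBlock.ext_apply fun t => ?_
    change ((h t : ℂ) • single i₀ j (1 : ℂ)) * star ((h t : ℂ) • single i₀ j (1 : ℂ)) =
      ((h t * h t : ℝ) : ℂ) • single i₀ i₀ (1 : ℂ)
    simp [Matrix.star_eq_conjTranspose]
  have hb2 : ∀ (h : C(unitInterval, ℝ)) (h0 : h 0 = 0) (h1 : h 1 = 0) (i j : Fin k × Fin n),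
      π (RazakBlock.bump h h0 h1 (single i j 1)) = 0 := fun h h0 h1 i j => by
    rw [← Matrix.conjTranspose_mul_self_eq_zero, ← Matrix.star_eq_conjTranspose, ← map_star,
      ← map_mul]
    have : star (RazakBlock.bump h h0 h1 (single i j 1)) * RazakBlock.bump h h0 h1 (single i j 1) =
        star (RazakBlock.bump h h0 h1 (single i₀ j 1)) *
          RazakBlock.bump h h0 h1 (single i₀ j 1) := by
      refine RazakBlock.ext_apply fun t => ?_
      change star ((h t : ℂ) • single i j (1 : ℂ)) * ((h t : ℂ) • single i j (1 : ℂ)) =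
        star ((h t : ℂ) • single i₀ j (1 : ℂ)) * ((h t : ℂ) • single i₀ j (1 : ℂ))
      simp [Matrix.star_eq_conjTranspose]
    rw [this, map_mul, hb1, mul_zero]
  have hf0 : f.1 0 = 0 := by
    rw [RazakBlock.apply_zero, hf]; exact Matrix.blockDiagonal_zero
  have hf1 : f.1 1 = 0 := by
    rw [RazakBlock.apply_one, hf]; simp only [ite_self]; exact Matrix.blockDiagonal_zero
  have hsum : f = ∑ i, ∑ j, (RazakBlock.bump ⟨fun t => (f.1 t i j).re, by fun_prop⟩
      (by simp [hf0]) (by simp [hf1]) (single i j 1) + Complex.I •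
        RazakBlock.bump ⟨fun t => (f.1 t i j).im, by fun_prop⟩
      (by simp [hf0]) (by simp [hf1]) (single i j 1)) := by
    refine RazakBlock.ext_apply fun t => ?_
    change pointRep t f = pointRep t _
    simp only [map_sum, map_add, map_smul]
    change f.1 t = ∑ i, ∑ j, (((f.1 t i j).re : ℂ) • single i j (1 : ℂ) +
      Complex.I • ((f.1 t i j).im : ℂ) • single i j (1 : ℂ))
    conv_lhs => rw [Matrix.matrix_eq_sum_single (f.1 t)]
    refine Finset.sum_congr rfl fun i _ => Finset.sum_congr rfl fun j _ => ?_
    rw [smul_smul, ← add_smul, mul_comm Complex.I, Complex.re_add_im]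
    simp
  rw [hsum]
  simp [map_sum, hb2]

/-- Here π factors through $M_k$ and is nonzero, so the image of the minimal projection $e_{00}$ is
a nonzero projection. A unit vector in its range has vector state $f \mapsto (a_f)_{00}$. -/
theorem exists_isometry_inftyRep [NeZero n] [NeZero k] {ι : Type} [Fintype ι] [DecidableEq ι]
    (π : RazakBlock n k →⋆ₙₐ[ℂ] Matrix ι ι ℂ)
    (hπ : ∀ f, inftyRep f = 0 → π f = 0) (f₀ : RazakBlock n k) (hf₀ : π f₀ ≠ 0) :
    ∃ W : Matrix ι (Fin k) ℂ, W.conjTranspose * W = 1 ∧ ∀ f, π f * W = W * inftyRep f := by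
  have hcongr : ∀ x y, inftyRep x = inftyRep y → π x = π y := fun x y h => by
    rw [← sub_eq_zero, ← map_sub]
    exact hπ _ (by rw [map_sub, h, sub_self])
  choose l hl using surjective_inftyRep (n := n) (k := k)
  have hp : π (l (single 0 0 1)) ≠ 0 := fun hp => by
    have hb1 : ∀ j, π (l (single 0 j 1)) = 0 := fun j => by
      rw [← Matrix.self_mul_conjTranspose_eq_zero, ← Matrix.star_eq_conjTranspose, ← map_star,
        ← map_mul, ← hp]
      apply hcongr
      simp [hl, map_mul, map_star, Matrix.star_eq_conjTranspose]
    have hb2 : ∀ i j, π (l (single i j 1)) = 0 := fun i j => by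
      rw [← Matrix.conjTranspose_mul_self_eq_zero, ← Matrix.star_eq_conjTranspose, ← map_star,
        ← map_mul, hcongr _ (star (l (single 0 j 1)) * l (single 0 j 1)), map_mul, hb1, mul_zero]
      simp [hl, map_mul, map_star, Matrix.star_eq_conjTranspose]
    refine hf₀ ?_
    rw [hcongr f₀ (∑ i, ∑ j, inftyRep f₀ i j • l (single i j 1))]
    · simp [map_sum, hb2]
    · conv_lhs => rw [Matrix.matrix_eq_sum_single (inftyRep f₀)]
      simp [map_sum, hl]
  have hself : star (π (l (single 0 0 1))) = π (l (single 0 0 1)) := by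
    rw [← map_star]
    apply hcongr
    simp [hl, map_star, Matrix.star_eq_conjTranspose]
  obtain ⟨ξ, χ, hξ, hχ, hχ1⟩ := exists_joint_eigenvector (fun _ : Unit => π (l (single 0 0 1)))
    (fun _ => hself) (fun _ _ => Commute.refl _) () hp
  have hχ2 : χ () = 1 := by
    have h1 : π (l (single 0 0 1)) *ᵥ (π (l (single 0 0 1)) *ᵥ ξ) = π (l (single 0 0 1)) *ᵥ ξ := by
      rw [Matrix.mulVec_mulVec, ← map_mul]
      congr 1
      apply hcongr
      simp [hl]
    rw [hχ (), Matrix.mulVec_smul, hχ (), smul_smul] at h1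
    have := congrArg (fun v => star ξ ⬝ᵥ v) h1
    simp only [dotProduct_smul, hξ, smul_eq_mul, mul_one] at this
    have h2 : χ () * χ () = χ () := by exact_mod_cast this
    exact mul_left_cancel₀ hχ1 (h2.trans (mul_one _).symm)
  have hfix : π (l (single 0 0 1)) *ᵥ ξ = ξ := by rw [hχ (), hχ2]; simp
  refine exists_isometry_of_vectorState surjective_inftyRep 0 ξ fun f => ?_
  have h3 : star ξ = star ξ ᵥ* π (l (single 0 0 1)) := by
    conv_lhs => rw [← hfix]
    rw [Matrix.star_mulVec, ← Matrix.star_eq_conjTranspose, hself]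
  have h2 : star ξ ⬝ᵥ (π f *ᵥ ξ) =
      star ξ ⬝ᵥ (π (l (single 0 0 1) * f * l (single 0 0 1)) *ᵥ ξ) := by
    rw [map_mul, map_mul, ← Matrix.mulVec_mulVec, hfix, ← Matrix.mulVec_mulVec,
      Matrix.dotProduct_mulVec _ (π (l (single 0 0 1))), ← h3]
  rw [h2, hcongr _ (inftyRep f 0 0 • l (single 0 0 1)), map_smul, Matrix.smul_mulVec, hfix,
    dotProduct_smul, hξ, smul_eq_mul, mul_one]
  simp [hl, Matrix.single_mul_mul_single]

end Irreducible

/-! ### Classification of finite-dimensional representations -/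

section Classification

variable {n k : ℕ} [NeZero n] [NeZero k]

theorem dsum_pointRep_uEquiv {X Y Z : Type} [Fintype X] [DecidableEq X] [Fintype Y]
    [DecidableEq Y] [Fintype Z] [DecidableEq Z] (t : unitInterval) (s : X → unitInterval) :
    UEquiv (dsum (pointRep t) (stdRep (n := n) (k := k) s Y Z))
      (stdRep (fun o : Option X => o.elim t s) Y Z) := by
  let e : (Fin k × Fin n) ⊕ (((Fin k × Fin n) × X) ⊕ ((Fin k × Y) ⊕ Z)) ≃
      ((Fin k × Fin n) × Option X) ⊕ ((Fin k × Y) ⊕ Z) :=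
    { toFun := Sum.elim (fun i => .inl (i, none))
        (Sum.elim (fun p => .inl (p.1, some p.2)) .inr)
      invFun := Sum.elim (fun p => p.2.elim (.inl p.1) fun x => .inr (.inl (p.1, x)))
        fun z => .inr (.inr z)
      left_inv := by rintro (i | ⟨i, x⟩ | z) <;> rfl
      right_inv := by rintro (⟨i, _ | x⟩ | z) <;> rfl }
  refine uEquiv_of_submatrix e fun f i j => ?_
  rcases i with i | ⟨i, x⟩ | ⟨i, y⟩ | z <;> rcases j with j | ⟨j, x'⟩ | ⟨j, y'⟩ | z' <;>
    simp [stdRep, dsum_apply, blockRep_apply, Matrix.blockDiagonal_apply, e]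

theorem dsum_inftyRep_uEquiv {X Y Z : Type} [Fintype X] [DecidableEq X] [Fintype Y]
    [DecidableEq Y] [Fintype Z] [DecidableEq Z] (s : X → unitInterval) :
    UEquiv (dsum inftyRep (stdRep (n := n) (k := k) s Y Z)) (stdRep s (Option Y) Z) := by
  let e : Fin k ⊕ (((Fin k × Fin n) × X) ⊕ ((Fin k × Y) ⊕ Z)) ≃
      ((Fin k × Fin n) × X) ⊕ ((Fin k × Option Y) ⊕ Z) :=
    { toFun := Sum.elim (fun i => .inr (.inl (i, none)))
        (Sum.elim .inl (Sum.elim (fun p => .inr (.inl (p.1, some p.2))) fun z => .inr (.inr z)))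
      invFun := Sum.elim (fun p => .inr (.inl p))
        (Sum.elim (fun p => p.2.elim (.inl p.1) fun x => .inr (.inr (.inl (p.1, x))))
          fun z => .inr (.inr (.inr z)))
      left_inv := by rintro (i | x | ⟨i, y⟩ | z) <;> rfl
      right_inv := by rintro (x | ⟨i, _ | y⟩ | z) <;> rfl }
  refine uEquiv_of_submatrix e fun f i j => ?_
  rcases i with i | ⟨i, x⟩ | ⟨i, y⟩ | z <;> rcases j with j | ⟨j, x'⟩ | ⟨j, y'⟩ | z' <;>
    simp [stdRep, dsum_apply, blockRep_apply, Matrix.blockDiagonal_apply, e]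

/-- Induction on the dimension: a nonzero representation contains a point evaluation if it is
nonzero on some bump, and otherwise the representation at infinity. Split that off and continue with
the complement. -/
theorem exists_uEquiv_stdRep_aux (m : ℕ) : ∀ (ι : Type) [Fintype ι] [DecidableEq ι],
    Fintype.card ι = m → ∀ π : RazakBlock n k →⋆ₙₐ[ℂ] Matrix ι ι ℂ,
    ∃ (a b c : ℕ) (s : Fin a → unitInterval), (∀ x, 0 < s x ∧ s x < 1) ∧
      UEquiv π (stdRep s (Fin b) (Fin c)) := by
  induction m using Nat.strong_induction_on with
  | _ m ih =>
  intro ι _ _ hm π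
  by_cases h0 : ∀ f, π f = 0
  · have e : ι ≃ ((Fin k × Fin n) × Fin 0) ⊕ ((Fin k × Fin 0) ⊕ Fin m) :=
      Fintype.equivOfCardEq (by simp [hm])
    refine ⟨0, 0, m, Fin.elim0, fun x => x.elim0, uEquiv_of_submatrix e fun f i j => ?_⟩
    rw [h0]
    generalize e i = i'
    generalize e j = j'
    rcases i' with ⟨_, x⟩ | ⟨_, x⟩ | i' <;> rcases j' with ⟨_, y⟩ | ⟨_, y⟩ | j' <;>
      first | exact x.elim0 | exact y.elim0 | rfl
  push Not at h0
  obtain ⟨f₀, hf₀⟩ := h0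
  by_cases hb : ∀ (h : C(unitInterval, ℝ)) (h0 : h 0 = 0) (h1 : h 1 = 0),
      π (RazakBlock.bump h h0 h1 (Matrix.single 0 0 1)) = 0
  · obtain ⟨W, hW, hπW⟩ := exists_isometry_inftyRep π (map_eq_zero_of_bump_eq_zero π 0 hb) f₀ hf₀
    obtain ⟨d, π', hπ'⟩ := exists_uEquiv_dsum W hW hπW
    have hd : d < m := by
      have := hπ'.card_eq
      have hk := NeZero.pos k
      simp at this
      omega
    obtain ⟨a, b, c, s, hs, hu⟩ := ih d hd (Fin d) (Fintype.card_fin d) π'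
    refine ⟨a, b + 1, c, s, hs, hπ'.trans ((hu.dsum_left _).trans
      ((dsum_inftyRep_uEquiv s).trans (stdRep_congr (Equiv.refl _) (fun _ => rfl)
        (finSuccEquiv b).symm (Equiv.refl _))))⟩
  · push Not at hb
    obtain ⟨h, h0, h1, hb⟩ := hb
    obtain ⟨t, ht0, ht1, W, hW, hπW⟩ := exists_isometry_pointRep π 0 h h0 h1 hb
    obtain ⟨d, π', hπ'⟩ := exists_uEquiv_dsum W hW hπW
    have hd : d < m := by
      have := hπ'.card_eq
      have hk := Nat.mul_pos (NeZero.pos k) (NeZero.pos n)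
      simp at this
      omega
    obtain ⟨a, b, c, s, hs, hu⟩ := ih d hd (Fin d) (Fintype.card_fin d) π'
    refine ⟨a + 1, b, c, Fin.cons t s, ?_, hπ'.trans ((hu.dsum_left _).trans
      ((dsum_pointRep_uEquiv t s).trans (stdRep_congr (finSuccEquiv a).symm ?_
        (Equiv.refl _) (Equiv.refl _))))⟩
    · intro x
      refine Fin.cases ⟨ht0, ht1⟩ (fun y => ?_) x
      simpa using hs y
    · rintro (_ | x) <;> simp

/-- Every representation of a Razak block on a matrix algebra is unitarily equivalent to a direct
sum of evaluations at interior points, copies of the representation at infinity, and zero. -/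
theorem exists_uEquiv_stdRep {ι : Type} [Fintype ι] [DecidableEq ι]
    (π : RazakBlock n k →⋆ₙₐ[ℂ] Matrix ι ι ℂ) :
    ∃ (a b c : ℕ) (s : Fin a → unitInterval), (∀ x, 0 < s x ∧ s x < 1) ∧
      UEquiv π (stdRep s (Fin b) (Fin c)) :=
  exists_uEquiv_stdRep_aux _ ι rfl π

/-- A bump that is 1 at t and 0 at both endpoints and all other points reads off the multiplicity of
t. Once the points agree, an element with $a_f = 1$ reads off the copies of infinity, and the
dimension fixes the zero block. -/
theorem uEquiv_stdRep_of_trace_eq {a b c a' b' c' : ℕ} {s : Fin a → unitInterval}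
    {s' : Fin a' → unitInterval} (hs : ∀ x, 0 < s x ∧ s x < 1) (hs' : ∀ x, 0 < s' x ∧ s' x < 1)
    (hcard : k * n * a + (k * b + c) = k * n * a' + (k * b' + c'))
    (htr : ∀ f, (stdRep (n := n) (k := k) s (Fin b) (Fin c) f).trace =
      (stdRep s' (Fin b') (Fin c') f).trace) :
    UEquiv (stdRep (n := n) (k := k) s (Fin b) (Fin c)) (stdRep s' (Fin b') (Fin c')) := by
  have hk : (k : ℂ) ≠ 0 := by exact_mod_cast NeZero.ne k
  have hn : (n : ℂ) ≠ 0 := by exact_mod_cast NeZero.ne n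
  have hcount : ∀ t, Fintype.card {x // s x = t} = Fintype.card {x // s' x = t} := fun t => by
    by_cases ht : 0 < t ∧ t < 1
    · obtain ⟨h, hht, hS⟩ := exists_bump (({0, 1} ∪ Set.range s ∪ Set.range s') \ {t})
        (Set.Finite.sdiff (((Set.toFinite _).union (Set.finite_range s)).union
          (Set.finite_range s'))) t (by simp)
      have h0 : h 0 = 0 := hS 0 ⟨by simp, ht.1.ne⟩
      have h1 : h 1 = 0 := hS 1 ⟨by simp, ht.2.ne'⟩
      have key : ∀ {a : ℕ} (b c : ℕ) (s : Fin a → unitInterval),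
          (∀ x, s x ≠ t → h (s x) = 0) →
          (stdRep (n := n) (k := k) s (Fin b) (Fin c) (RazakBlock.bump h h0 h1 1)).trace =
            Fintype.card {x // s x = t} * (k * n) := fun b c s hs => by
        have hinf : inftyRep (RazakBlock.bump (n := n) (k := k) h h0 h1 1) = 0 := by
          change Matrix.blockDiag ((h 0 : ℂ) • 1) 0 = 0
          rw [h0, Complex.ofReal_zero, zero_smul]
          rfl
        rw [trace_stdRep, hinf, Matrix.trace_zero, mul_zero, add_zero, Fintype.card_subtype,
          Finset.card_filter, Nat.cast_sum, Finset.sum_mul]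
        refine Finset.sum_congr rfl fun x _ => ?_
        rw [RazakBlock.bump_apply, Matrix.trace_smul, Matrix.trace_one]
        by_cases hx : s x = t
        · simp [hx, hht]
        · simp [hx, hs x hx]
      have e := htr (RazakBlock.bump h h0 h1 1)
      rw [key b c s fun x hx => hS _ ⟨by simp, hx⟩, key b' c' s' fun x hx => hS _ ⟨by simp, hx⟩] at e
      exact_mod_cast mul_right_cancel₀ (mul_ne_zero hk hn) e
    · have : IsEmpty {x // s x = t} := ⟨fun x => ht (x.2 ▸ hs x.1)⟩
      have : IsEmpty {x // s' x = t} := ⟨fun x => ht (x.2 ▸ hs' x.1)⟩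
      simp
  let e : Fin a ≃ Fin a' := Equiv.ofFiberEquiv (f := s) (g := s')
    fun t => Fintype.equivOfCardEq (hcount t)
  have he : ∀ x, s' (e x) = s x := Equiv.ofFiberEquiv_map _
  have ha : a = a' := by simpa using Fintype.card_congr e
  have hb : b = b' := by
    have e1 := htr (RazakBlock.lift symmCoe (by simp [symmCoe]) (by simp [symmCoe]) 1)
    rw [trace_stdRep, trace_stdRep, ← Equiv.sum_comp e] at e1
    simp only [he, add_right_inj, RazakBlock.inftyRep_lift, Matrix.trace_one, Fintype.card_fin]
      at e1
    exact_mod_cast mul_right_cancel₀ hk e1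
  have hc : c = c' := by subst ha hb; omega
  subst hb hc
  exact stdRep_congr e he (Equiv.refl _) (Equiv.refl _)

/-- Two representations of a Razak block of the same dimension and with the same trace are
unitarily equivalent. -/
theorem uEquiv_of_trace_eq {ι ι' : Type} [Fintype ι] [DecidableEq ι] [Fintype ι'] [DecidableEq ι']
    (π : RazakBlock n k →⋆ₙₐ[ℂ] Matrix ι ι ℂ) (ρ : RazakBlock n k →⋆ₙₐ[ℂ] Matrix ι' ι' ℂ)
    (hcard : Fintype.card ι = Fintype.card ι') (htr : ∀ f, (π f).trace = (ρ f).trace) :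
    UEquiv π ρ := by
  obtain ⟨a, b, c, s, hs, hu⟩ := exists_uEquiv_stdRep π
  obtain ⟨a', b', c', s', hs', hu'⟩ := exists_uEquiv_stdRep ρ
  refine hu.trans ((uEquiv_stdRep_of_trace_eq hs hs' ?_ fun f => ?_).trans hu'.symm)
  · have h1 := hu.card_eq
    have h2 := hu'.card_eq
    simp at h1 h2
    omega
  · rw [← hu.trace_eq, ← hu'.trace_eq, htr]

end Classification

/-! ### Matching points in increasing order -/

section SortedMatching

/-- Two families of points of the unit interval of the same size whose tail counts interlace up to
`η` can be matched so that matched points are at distance at most `η`. -/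
theorem exists_equiv_close_fin {p : ℕ} (s s' : Fin p → unitInterval) (η : ℝ)
    (h : ∀ z : ℝ, 0 ≤ z → z + η < 1 →
      (Finset.univ.filter fun x => z + η < s x).card ≤ (Finset.univ.filter fun x => z < s' x).card) :
    ∀ i, (s (Tuple.sort s i) : ℝ) ≤ s' (Tuple.sort s' i) + η := by
  intro i
  by_contra! hi
  -- If the bound failed at i, all p - i points of s ranked i or higher would exceed z + η, while at
  -- most p - i - 1 points of s' exceed z.
  let z : ℝ := (s' (Tuple.sort s' i)).1
  have h1 := h z (s' _).2.1 (hi.trans_le (s _).2.2)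
  have h2 : (Finset.Ici i).card ≤ (Finset.univ.filter fun x => z + η < s x).card := by
    refine Finset.card_le_card_of_injOn (Tuple.sort s) (fun j hj => ?_)
      (Tuple.sort s).injective.injOn
    rw [Finset.mem_coe, Finset.mem_Ici] at hj
    rw [Finset.mem_coe, Finset.mem_filter]
    exact ⟨Finset.mem_univ _, hi.trans_le (Tuple.monotone_sort s hj)⟩
  have h3 : (Finset.univ.filter fun x => z < s' x).card ≤ (Finset.Ioi i).card := by
    refine Finset.card_le_card_of_injOn (Tuple.sort s').symm (fun j hj => ?_)
      (Tuple.sort s').symm.injective.injOn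
    rw [Finset.mem_coe, Finset.mem_filter] at hj
    rw [Finset.mem_coe, Finset.mem_Ioi]
    by_contra! hle
    have := Tuple.monotone_sort s' hle
    simp only [Function.comp_apply, Equiv.apply_symm_apply] at this
    exact absurd hj.2 (not_lt.2 this)
  have h4 : (Finset.Ioi i).card < (Finset.Ici i).card := by
    refine Finset.card_lt_card ⟨Finset.Ioi_subset_Ici_self, fun hsub => ?_⟩
    exact lt_irrefl i (Finset.mem_Ioi.1 (hsub (Finset.mem_Ici.2 le_rfl)))
  omega

theorem exists_equiv_close {X X' : Type} [Fintype X] [Fintype X']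
    (hcard : Fintype.card X = Fintype.card X') (s : X → unitInterval) (s' : X' → unitInterval)
    (η : ℝ)
    (h : ∀ z : ℝ, 0 ≤ z → z + η < 1 →
      (Finset.univ.filter fun x => z + η < s x).card ≤ (Finset.univ.filter fun x => z < s' x).card)
    (h' : ∀ z : ℝ, 0 ≤ z → z + η < 1 →
      (Finset.univ.filter fun x => z + η < s' x).card ≤
        (Finset.univ.filter fun x => z < s x).card) :
    ∃ e : X ≃ X', ∀ x, |(s x : ℝ) - s' (e x)| ≤ η := by
  let E : Fin (Fintype.card X) ≃ X := (Fintype.equivFin X).symm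
  let E' : Fin (Fintype.card X) ≃ X' := (Fintype.equivFinOfCardEq hcard.symm).symm
  have hc : ∀ {Y : Type} [Fintype Y] (F : Fin (Fintype.card X) ≃ Y) (t : Y → unitInterval) (z : ℝ),
      (Finset.univ.filter fun x => z < (t ∘ F) x).card =
        (Finset.univ.filter fun x => z < t x).card := fun F t z => by
    rw [Finset.card_filter, Finset.card_filter]
    exact Equiv.sum_comp F fun x => if z < t x then 1 else 0
  have k1 := exists_equiv_close_fin (s ∘ E) (s' ∘ E') η fun z hz hz' => by
    rw [hc E s, hc E' s']; exact h z hz hz'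
  have k2 := exists_equiv_close_fin (s' ∘ E') (s ∘ E) η fun z hz hz' => by
    rw [hc E s, hc E' s']; exact h' z hz hz'
  refine ⟨((E.symm.trans (Tuple.sort (s ∘ E)).symm).trans (Tuple.sort (s' ∘ E'))).trans E',
    fun x => ?_⟩
  obtain ⟨i, rfl⟩ : ∃ i, x = E (Tuple.sort (s ∘ E) i) :=
    ⟨(Tuple.sort (s ∘ E)).symm (E.symm x), by simp⟩
  have a1 := k1 i
  have a2 := k2 i
  simp only [Function.comp_apply] at a1 a2
  simp only [Equiv.trans_apply, Equiv.symm_apply_apply]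
  rw [abs_le]
  constructor <;> linarith

end SortedMatching

/-! ### Approximate unitary equivalence -/

section Near

variable {A : Type*} [NonUnitalCStarAlgebra A]
variable {ι ι' ι'' : Type} [Fintype ι] [DecidableEq ι] [Fintype ι'] [DecidableEq ι']
  [Fintype ι''] [DecidableEq ι'']

/-- Two representations are unitarily equivalent up to `c` on the set `G`. -/
def UNear (G : Set A) (c : ℝ) (π : A →⋆ₙₐ[ℂ] Matrix ι ι ℂ) (ρ : A →⋆ₙₐ[ℂ] Matrix ι' ι' ℂ) : Prop :=
  ∃ u : Matrix ι ι' ℂ, u * u.conjTranspose = 1 ∧ u.conjTranspose * u = 1 ∧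
    ∀ f ∈ G, ‖π f - u * ρ f * u.conjTranspose‖ ≤ c

theorem UEquiv.uNear {π : A →⋆ₙₐ[ℂ] Matrix ι ι ℂ} {ρ : A →⋆ₙₐ[ℂ] Matrix ι' ι' ℂ}
    (h : UEquiv π ρ) (G : Set A) : UNear G 0 π ρ := by
  obtain ⟨u, h1, h2, h3⟩ := h
  exact ⟨u, h1, h2, fun f _ => by rw [h3, sub_self, norm_zero]⟩

theorem uNear_of_norm_sub_le {G : Set A} {c : ℝ} {π ρ : A →⋆ₙₐ[ℂ] Matrix ι ι ℂ}
    (h : ∀ f ∈ G, ‖π f - ρ f‖ ≤ c) : UNear G c π ρ :=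
  ⟨1, by simp, by simp, fun f hf => by simpa using h f hf⟩

theorem UNear.symm {G : Set A} {c : ℝ} {π : A →⋆ₙₐ[ℂ] Matrix ι ι ℂ}
    {ρ : A →⋆ₙₐ[ℂ] Matrix ι' ι' ℂ} (h : UNear G c π ρ) : UNear G c ρ π := by
  obtain ⟨u, h1, h2, h3⟩ := h
  refine ⟨u.conjTranspose, by simpa using h2, by simpa using h1, fun f hf => ?_⟩
  have e : ρ f - u.conjTranspose * π f * u.conjTranspose.conjTranspose =
      u.conjTranspose * (-(π f - u * ρ f * u.conjTranspose)) * u.conjTranspose.conjTranspose := by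
    have h4 : u.conjTranspose * (u * ρ f * u.conjTranspose) * u = ρ f := by
      rw [← Matrix.mul_assoc, ← Matrix.mul_assoc, h2, Matrix.one_mul, Matrix.mul_assoc, h2,
        Matrix.mul_one]
    rw [Matrix.conjTranspose_conjTranspose, neg_sub, Matrix.mul_sub, Matrix.sub_mul, h4]
  rw [e]
  refine (norm_conj_le (by simpa using h2) (by simpa using h1) _).trans ?_
  rw [norm_neg]
  exact h3 f hf

theorem UNear.trans {G : Set A} {c c' : ℝ} {π : A →⋆ₙₐ[ℂ] Matrix ι ι ℂ}
    {ρ : A →⋆ₙₐ[ℂ] Matrix ι' ι' ℂ} {θ : A →⋆ₙₐ[ℂ] Matrix ι'' ι'' ℂ} (h : UNear G c π ρ)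
    (h' : UNear G c' ρ θ) : UNear G (c + c') π θ := by
  obtain ⟨u, h1, h2, h3⟩ := h
  obtain ⟨v, k1, k2, k3⟩ := h'
  refine ⟨u * v, ?_, ?_, fun f hf => ?_⟩
  · rw [Matrix.conjTranspose_mul, Matrix.mul_assoc, ← Matrix.mul_assoc v, k1, Matrix.one_mul, h1]
  · rw [Matrix.conjTranspose_mul, Matrix.mul_assoc, ← Matrix.mul_assoc _ u, h2, Matrix.one_mul, k2]
  · have e : π f - u * v * θ f * (u * v).conjTranspose = (π f - u * ρ f * u.conjTranspose) +
        u * (ρ f - v * θ f * v.conjTranspose) * u.conjTranspose := by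
      rw [Matrix.mul_sub, Matrix.sub_mul, Matrix.conjTranspose_mul]
      simp only [Matrix.mul_assoc, sub_add_sub_cancel]
    rw [e]
    exact (norm_add_le _ _).trans (add_le_add (h3 f hf) ((norm_conj_le h1 h2 _).trans (k3 f hf)))

theorem UNear.unitaryDist_le {G : Set A} {c : ℝ} {π ρ : A →⋆ₙₐ[ℂ] Matrix ι ι ℂ}
    (h : UNear G c π ρ) : unitaryDist G π ρ ≤ ENNReal.ofReal c := by
  obtain ⟨u, h1, h2, h3⟩ := h
  refine iInf_le_of_le ⟨u, Unitary.mem_iff.2 ⟨h2, h1⟩⟩ (iSup₂_le fun f hf => ?_)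
  rw [← ofReal_norm]
  exact ENNReal.ofReal_le_ofReal (h3 f hf)

end Near

/-! ### Moving points, and the arithmetic of the multiplicities -/

section Matching

variable {n k : ℕ} [NeZero n] [NeZero k]

theorem uNear_stdRep {X Y Z : Type} [Fintype X] [DecidableEq X] [Fintype Y]
    [DecidableEq Y] [Fintype Z] [DecidableEq Z] (G : Set (RazakBlock n k)) {c : ℝ} (hc : 0 ≤ c)
    (s s' : X → unitInterval) (h : ∀ f ∈ G, ∀ x, ‖f.1 (s x) - f.1 (s' x)‖ ≤ c) :
    UNear G c (stdRep s Y Z) (stdRep s' Y Z) :=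
  uNear_of_norm_sub_le fun f hf => norm_dsum_blockRep_sub_le _ _ _ f hc (h f hf)

/-- Bookkeeping for the endpoint relations: e points at 1 use up (n-1)e copies of infinity and ke
zeros, while each of the y or y' points at 0 uses n copies of infinity. The aim is equal numbers of
points and a common remainder β of copies of infinity. -/
theorem exists_block_counts {n k i i' B B' C C' e R : ℕ} (hn : 0 < n) (hk : 0 < k)
    (hdim : k * n * i + k * B + C = k * n * i' + k * B' + C') (hC : C = C' + k * e)
    (he : e ≤ R) (hB : (n - 1) * R ≤ B) :
    ∃ y y' β, (n - 1) * e + n * y + β = B ∧ n * y' + β = B' ∧ i + e + y = i' + y' := by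
  obtain ⟨m, rfl⟩ : ∃ m, n = m + 1 := ⟨n - 1, by omega⟩
  simp only [Nat.add_sub_cancel] at *
  have h1 : (m + 1) * i + B + e = (m + 1) * i' + B' := by
    have : k * ((m + 1) * i + B + e) = k * ((m + 1) * i' + B') := by
      rw [hC] at hdim
      nlinarith
    exact Nat.eq_of_mul_eq_mul_left hk this
  -- Only the side with fewer points receives points at 0. In the first case the dimension identity
  -- supplies enough copies of infinity; in the second, `he` and `hB` guarantee that the points at 1
  -- can be paid for.
  rcases le_total (i + e) i' with h | h
  · obtain ⟨y, rfl⟩ := Nat.exists_eq_add_of_le h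
    exact ⟨y, 0, B', by nlinarith, by simp, by ring⟩
  · obtain ⟨y, hy⟩ := Nat.exists_eq_add_of_le h
    have h2 : m * e ≤ B := (Nat.mul_le_mul_left m he).trans hB
    obtain ⟨β, rfl⟩ := Nat.exists_eq_add_of_le h2
    refine ⟨0, y, β, by ring, ?_, by omega⟩
    have : i + e = i' + y := hy
    nlinarith

end Matching

/-! ### From comparable tail counts to approximate equivalence -/

section Matching

variable {n k : ℕ} [NeZero n] [NeZero k]

theorem sum_subtype_indicator {a : ℕ} (p q : Fin a → Prop) [DecidablePred p] [DecidablePred q] :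
    (∑ x : {x // p x}, if q x.1 then 1 else 0) =
      (Finset.univ.filter fun x => p x ∧ q x).card := by
  rw [← Finset.sum_subtype (Finset.univ.filter p) (by simp) fun x => if q x then 1 else 0,
    ← Finset.card_filter, Finset.filter_filter]

/-- The points `s x` below `w`, together with `e` points at `1` and `y` points at `0`. -/
def truncatedPoints {a : ℕ} (s : Fin a → unitInterval) (w : ℝ) (e y : ℕ) :
    {x // (s x : ℝ) < w} ⊕ (Fin e ⊕ Fin y) → unitInterval :=
  Sum.elim (fun x => s x.1) (Sum.elim (fun _ => 1) fun _ => 0)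

theorem card_lt_truncatedPoints {a : ℕ} (s : Fin a → unitInterval) (w : ℝ) (e y : ℕ) {z : ℝ}
    (hz : 0 ≤ z) (hz1 : z < 1) : (Finset.univ.filter fun x => z < truncatedPoints s w e y x).card =
      (Finset.univ.filter fun x => (s x : ℝ) < w ∧ z < s x).card + e := by
  rw [Finset.card_filter, Fintype.sum_sum_type, Fintype.sum_sum_type]
  refine congrArg₂ (· + ·)
    (sum_subtype_indicator (fun x => (s x : ℝ) < w) fun x => z < (s x : ℝ)) ?_
  simp [truncatedPoints, hz1, not_lt.2 hz]

/-- Both sides have equal dimension and trace by the endpoint relations, so no explicit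
rearrangement of blocks is needed. -/
theorem stdRep_uEquiv_truncatedPoints {a b c : ℕ} (s : Fin a → unitInterval) (w : ℝ)
    {e y β γ : ℕ}
    (h1 : (n - 1) * e + n * y + β = b + (n - 1) * (Finset.univ.filter fun x => w ≤ s x).card)
    (h2 : c + k * (Finset.univ.filter fun x => w ≤ s x).card = γ + k * e) :
    UEquiv (stdRep (n := n) (k := k) (fun x => if w ≤ s x then 1 else s x) (Fin b) (Fin c))
      (stdRep (truncatedPoints s w e y) (Fin β) (Fin γ)) := by
  obtain ⟨m, hm⟩ : ∃ m, n = m + 1 := Nat.exists_eq_succ_of_ne_zero (NeZero.ne n)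
  have ha : Fintype.card {x // (s x : ℝ) < w} + (Finset.univ.filter fun x => w ≤ s x).card = a := by
    rw [Fintype.card_subtype]
    simpa using Finset.card_filter_add_card_filter_not (s := Finset.univ) fun x => (s x : ℝ) < w
  set R := (Finset.univ.filter fun x => w ≤ s x).card with hR
  refine uEquiv_of_trace_eq _ _ ?_ fun f => ?_
  · simp only [Fintype.card_sum, Fintype.card_prod, Fintype.card_fin]
    have ha2 : k * n * a = k * n * (Fintype.card {x // (s x : ℝ) < w} + R) := by rw [ha]
    rw [ha2]
    generalize Fintype.card {x // (s x : ℝ) < w} = i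
    subst hm
    simp only [Nat.add_sub_cancel] at h1
    have h3 : k * (m * e + (m + 1) * y + β) = k * (b + m * R) := by rw [h1]
    nlinarith
  · rw [trace_stdRep, trace_stdRep, Fintype.sum_sum_type, Fintype.sum_sum_type]
    simp only [truncatedPoints, Sum.elim_inl, Sum.elim_inr, Finset.sum_const, Finset.card_univ,
      Fintype.card_fin, nsmul_eq_mul, RazakBlock.trace_apply_zero, RazakBlock.trace_apply_one]
    rw [← Finset.sum_subtype (Finset.univ.filter fun x => (s x : ℝ) < w) (by simp)
      fun x => (f.1 (s x)).trace]
    have h4 : ∑ x, (f.1 (if w ≤ s x then 1 else s x)).trace =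
        (∑ x ∈ Finset.univ.filter fun x => (s x : ℝ) < w, (f.1 (s x)).trace) +
          R * ((n - 1) * (inftyRep f).trace) := by
      rw [← Finset.sum_filter_add_sum_filter_not Finset.univ fun x => (s x : ℝ) < w]
      congr 1
      · refine Finset.sum_congr rfl fun x hx => ?_
        rw [if_neg (not_le.2 (Finset.mem_filter.1 hx).2)]
      · rw [Finset.sum_congr rfl (g := fun _ => (n - 1) * (inftyRep f).trace) fun x hx => by
          rw [if_pos (not_lt.1 (Finset.mem_filter.1 hx).2), RazakBlock.trace_apply_one]]
        simp only [Finset.sum_const, nsmul_eq_mul, not_lt, hR]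
    rw [h4]
    have h5 : ((n : ℂ) - 1) * e + n * y + β = b + (n - 1) * R := by
      subst hm
      simp only [Nat.add_sub_cancel] at h1
      push_cast
      rw [add_sub_cancel_right]
      exact_mod_cast h1
    linear_combination -(inftyRep f).trace * h5

/-- The comparison of tail counts under which two representations can be matched. -/
def TailLE (k : ℕ) (M : ℝ) {a a' : ℕ} (s : Fin a → unitInterval) (c : ℕ)
    (s' : Fin a' → unitInterval) (c' : ℕ) : Prop :=
  ∀ z v : ℝ, 0 ≤ z → z ≤ 1 - 2 / M → z + 3 / M ≤ v →
    c + k * (Finset.univ.filter fun x => v ≤ s x).card ≤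
      c' + k * (Finset.univ.filter fun x => z < s' x).card

/-- The margin 5/M is the 3/M of the tail comparison plus the 2/M of the cutoff: it puts z + 3/M
below 1 - 2/M, so that every point beyond the cutoff is counted in the tail. -/
theorem TailLE.card_truncated_le {M : ℝ} (hM : 0 < M) {a a' c c' : ℕ} {s : Fin a → unitInterval}
    {s' : Fin a' → unitInterval} (h : TailLE k M s c s' c') {z : ℝ} (hz : 0 ≤ z)
    (hz1 : z + 5 / M < 1) :
    k * (Finset.univ.filter fun x => (s x : ℝ) < 1 - 2 / M ∧ z + 5 / M < s x).card +
        (c + k * (Finset.univ.filter fun x => 1 - 2 / M ≤ (s x : ℝ)).card) ≤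
      k * (Finset.univ.filter fun x => (s' x : ℝ) < 1 - 2 / M ∧ z < s' x).card +
        (c' + k * (Finset.univ.filter fun x => 1 - 2 / M ≤ (s' x : ℝ)).card) := by
  have hM' : 5 / M = 3 / M + 2 / M := by rw [← add_div]; norm_num
  have hM3 : 0 < 3 / M := by positivity
  have hM2 : 0 < 2 / M := by positivity
  have h1 := h z (z + 3 / M) hz (by linarith) le_rfl
  have h2 : (Finset.univ.filter fun x => (s x : ℝ) < 1 - 2 / M ∧ z + 5 / M < s x).card +
      (Finset.univ.filter fun x => 1 - 2 / M ≤ (s x : ℝ)).card ≤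
      (Finset.univ.filter fun x => z + 3 / M ≤ (s x : ℝ)).card := by
    rw [← Finset.card_union_of_disjoint]
    · refine Finset.card_le_card fun x hx => ?_
      simp only [Finset.mem_union, Finset.mem_filter, Finset.mem_univ, true_and] at hx ⊢
      rcases hx with hx | hx <;> linarith
    · refine Finset.disjoint_filter.2 fun x _ hx hx' => ?_
      linarith
  have h3 : (Finset.univ.filter fun x => z < (s' x : ℝ)).card ≤
      (Finset.univ.filter fun x => (s' x : ℝ) < 1 - 2 / M ∧ z < s' x).card +
        (Finset.univ.filter fun x => 1 - 2 / M ≤ (s' x : ℝ)).card := by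
    rw [← Finset.card_union_of_disjoint]
    · refine Finset.card_le_card fun x hx => ?_
      simp only [Finset.mem_union, Finset.mem_filter, Finset.mem_univ, true_and] at hx ⊢
      rcases lt_or_ge (s' x : ℝ) (1 - 2 / M) with h | h
      · exact Or.inl ⟨h, hx⟩
      · exact Or.inr h
    · refine Finset.disjoint_filter.2 fun x _ hx hx' => ?_
      linarith
  have h4 := Nat.mul_le_mul_left k h2
  have h5 := Nat.mul_le_mul_left k h3
  rw [Nat.mul_add] at h4 h5
  omega

/-- Points beyond w = 1 - 2/M are pushed to 1 on both sides. The surplus ke of zeros on the first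
side is recombined into e points at 1, and points at 0 equalise the counts; then sorted matching
applies. The three errors ε come from the two pushes and the matching. -/
theorem uNear_stdRep_of_tailLE_aux {M : ℝ} (hM : 2 ≤ M) {a a' b b' c c' : ℕ}
    {s : Fin a → unitInterval} {s' : Fin a' → unitInterval}
    (hdim : k * n * a + (k * b + c) = k * n * a' + (k * b' + c'))
    (h : TailLE k M s c s' c') (h' : TailLE k M s' c' s c)
    (hle : c' + k * (Finset.univ.filter fun x => 1 - 2 / M ≤ (s' x : ℝ)).card ≤
      c + k * (Finset.univ.filter fun x => 1 - 2 / M ≤ (s x : ℝ)).card)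
    (G : Set (RazakBlock n k)) {ε : ℝ} (hε : 0 ≤ ε)
    (hG : ∀ f ∈ G, ∀ t t' : unitInterval, |(t : ℝ) - t'| ≤ 5 / M → ‖f.1 t - f.1 t'‖ ≤ ε) :
    UNear G (3 * ε) (stdRep s (Fin b) (Fin c)) (stdRep s' (Fin b') (Fin c')) := by
  have hM0 : 0 < M := by linarith
  set w : ℝ := 1 - 2 / M with hw
  have hw0 : 0 ≤ w := by
    have : 2 / M ≤ 1 := (div_le_one hM0).2 hM
    linarith
  set R := (Finset.univ.filter fun x => w ≤ (s x : ℝ)).card with hR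
  set R' := (Finset.univ.filter fun x => w ≤ (s' x : ℝ)).card with hR'
  have hcut : ∀ {a : ℕ} (s : Fin a → unitInterval), Fintype.card {x // (s x : ℝ) < w} +
      (Finset.univ.filter fun x => w ≤ (s x : ℝ)).card = a := fun s => by
    rw [Fintype.card_subtype]
    simpa using Finset.card_filter_add_card_filter_not (s := Finset.univ) fun x => (s x : ℝ) < w
  have ha := hcut s
  have ha' := hcut s'
  obtain ⟨m, hm⟩ : ∃ m, n = m + 1 := Nat.exists_eq_succ_of_ne_zero (NeZero.ne n)
  have hdim' : k * n * Fintype.card {x // (s x : ℝ) < w} + k * (b + (n - 1) * R) + (c + k * R) =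
      k * n * Fintype.card {x // (s' x : ℝ) < w} + k * (b' + (n - 1) * R') + (c' + k * R') := by
    rw [← ha, ← ha'] at hdim
    rw [← hR, ← hR', hm] at hdim
    rw [hm, Nat.add_sub_cancel]
    nlinarith
  -- All other summands have dimension divisible by k, so the zero dimensions agree modulo k.
  obtain ⟨e, he⟩ : ∃ e, c + k * R = c' + k * R' + k * e := by
    have h1 : c + k * R ≡ c' + k * R' [MOD k] := by
      have h2 : ∀ i B C : ℕ, k * n * i + k * B + C ≡ C [MOD k] := fun i B C => by
        rw [mul_assoc, ← Nat.mul_add]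
        simp [Nat.ModEq]
      have h3 := h2 (Fintype.card {x // (s x : ℝ) < w}) (b + (n - 1) * R) (c + k * R)
      rw [hdim'] at h3
      exact h3.symm.trans (h2 _ _ _)
    obtain ⟨e, he⟩ := (Nat.modEq_iff_dvd' hle).1 h1.symm
    exact ⟨e, by omega⟩
  have heR : e ≤ R := by
    -- At the largest admissible threshold this gives c ≤ c' + kR', so the surplus ke is at most kR:
    -- no more points are needed at 1 than were pushed there.
    have h1 := h w (w + 3 / M) hw0 le_rfl le_rfl
    have h2 : (Finset.univ.filter fun x => w < (s' x : ℝ)).card ≤ R' :=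
      Finset.card_le_card (Finset.monotone_filter_right _ fun x _ hx => le_of_lt hx)
    have h3 := Nat.mul_le_mul_left k h2
    have h4 : k * e ≤ k * R := by omega
    exact Nat.le_of_mul_le_mul_left h4 (NeZero.pos k)
  obtain ⟨y, y', β, hy, hy', hyy⟩ := exists_block_counts (NeZero.pos n) (NeZero.pos k) hdim' he heR
    (Nat.le_add_left _ _)
  have k1 := stdRep_uEquiv_truncatedPoints (n := n) (k := k) (γ := c' + k * R') s w hy he
  have k2 := stdRep_uEquiv_truncatedPoints (n := n) (k := k) (b := b') (c := c') (e := 0) (y := y')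
    (β := β)     (γ := c' + k * R') s' w (by rw [← hR', ← hy']; simp) (by simp [hR'])
  have hnear : ∀ {a : ℕ} (b c : ℕ) (s : Fin a → unitInterval),
      UNear G ε (stdRep (n := n) (k := k) s (Fin b) (Fin c))
        (stdRep (fun x => if w ≤ s x then 1 else s x) (Fin b) (Fin c)) := fun b c s =>
    uNear_stdRep G hε _ _ fun f hf x => by
      refine hG f hf _ _ ?_
      have hM2 : 2 / M ≤ 5 / M := by gcongr; norm_num
      have hM5 : 0 < 5 / M := by positivity
      split_ifs with hx
      · have h1 := (s x).2.2
        rw [Set.Icc.coe_one, abs_sub_comm, abs_of_nonneg (by linarith)]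
        linarith
      · simp [hM5.le]
  obtain ⟨E, hE⟩ := exists_equiv_close (by simp; omega) (truncatedPoints s w e y)
    (truncatedPoints s' w 0 y') (5 / M) (fun z hz hz1 => by
      have hM5 : 0 < 5 / M := by positivity
      rw [card_lt_truncatedPoints s w e y (by linarith) hz1,
        card_lt_truncatedPoints s' w 0 y' hz (by linarith)]
      have h1 := h.card_truncated_le hM0 hz hz1
      refine Nat.le_of_mul_le_mul_left ?_ (NeZero.pos k)
      rw [Nat.mul_add, add_zero]
      simp only [← hw, ← hR, ← hR'] at h1
      omega) (fun z hz hz1 => by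
      have hM5 : 0 < 5 / M := by positivity
      rw [card_lt_truncatedPoints s w e y hz (by linarith),
        card_lt_truncatedPoints s' w 0 y' (by linarith) hz1]
      have h1 := h'.card_truncated_le hM0 hz hz1
      refine Nat.le_of_mul_le_mul_left ?_ (NeZero.pos k)
      rw [Nat.mul_add k _ e, add_zero]
      simp only [← hw, ← hR, ← hR'] at h1
      omega)
  have k3 : UNear G ε (stdRep (n := n) (k := k) (truncatedPoints s w e y) (Fin β)
      (Fin (c' + k * R'))) (stdRep (truncatedPoints s' w 0 y' ∘ E) (Fin β) (Fin (c' + k * R'))) :=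
    uNear_stdRep G hε _ _ fun f hf x => hG f hf _ _ (hE x)
  have k4 : UEquiv (stdRep (n := n) (k := k) (truncatedPoints s' w 0 y' ∘ E) (Fin β)
      (Fin (c' + k * R'))) (stdRep (truncatedPoints s' w 0 y') (Fin β) (Fin (c' + k * R'))) :=
    stdRep_congr E (fun _ => rfl) (Equiv.refl _) (Equiv.refl _)
  have := (((((hnear b c s).trans (k1.uNear G)).trans k3).trans (k4.uNear G)).trans
    (k2.symm.uNear G)).trans (hnear b' c' s').symm
  convert this using 1
  ring

theorem uNear_stdRep_of_tailLE {M : ℝ} (hM : 2 ≤ M) {a a' b b' c c' : ℕ}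
    {s : Fin a → unitInterval} {s' : Fin a' → unitInterval}
    (hdim : k * n * a + (k * b + c) = k * n * a' + (k * b' + c'))
    (h : TailLE k M s c s' c') (h' : TailLE k M s' c' s c)
    (G : Set (RazakBlock n k)) {ε : ℝ} (hε : 0 ≤ ε)
    (hG : ∀ f ∈ G, ∀ t t' : unitInterval, |(t : ℝ) - t'| ≤ 5 / M → ‖f.1 t - f.1 t'‖ ≤ ε) :
    UNear G (3 * ε) (stdRep s (Fin b) (Fin c)) (stdRep s' (Fin b') (Fin c')) := by
  rcases le_total (c' + k * (Finset.univ.filter fun x => 1 - 2 / M ≤ (s' x : ℝ)).card)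
    (c + k * (Finset.univ.filter fun x => 1 - 2 / M ≤ (s x : ℝ)).card) with hle | hle
  · exact uNear_stdRep_of_tailLE_aux hM hdim h h' hle G hε hG
  · exact (uNear_stdRep_of_tailLE_aux hM hdim.symm h' h hle G hε hG).symm

end Matching

/-! ### Closeness of traces implies approximate unitary equivalence -/

section Uniqueness

variable {n k : ℕ} [NeZero n] [NeZero k]

theorem eventually_norm_sub_le {E : Type*} [NormedAddCommGroup E] (f : C(unitInterval, E)) (c : ℝ)
    {ε : ℝ} (hε : 0 < ε) : ∀ᶠ M : ℕ in Filter.atTop, ∀ t t' : unitInterval,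
      |(t : ℝ) - t'| ≤ c / M → ‖f t - f t'‖ ≤ ε := by
  obtain ⟨δ, hδ, h⟩ := Metric.uniformContinuous_iff.1
    (CompactSpace.uniformContinuous_of_continuous f.continuous) ε hε
  filter_upwards [(tendsto_const_div_atTop_nhds_zero_nat c).eventually (gt_mem_nhds hδ)]
    with M hM t t' ht
  rw [← dist_eq_norm]
  exact (h (show dist t t' < δ from ht.trans_lt hM)).le

/-- The piecewise linear function that is `0` on `[0, j / M]` and `1` on `[(j + 1) / M, 1]`. -/
noncomputable def ramp (M j : ℕ) : C(unitInterval, ℝ) :=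
  ⟨fun t => max 0 (min 1 (M * (t : ℝ) - j)), by fun_prop⟩

theorem ramp_apply (M j : ℕ) (t : unitInterval) : ramp M j t = max 0 (min 1 (M * (t : ℝ) - j)) := rfl

theorem ramp_nonneg (M j : ℕ) (t : unitInterval) : 0 ≤ ramp M j t := le_max_left _ _

theorem ramp_le_one (M j : ℕ) (t : unitInterval) : ramp M j t ≤ 1 :=
  max_le zero_le_one (min_le_left _ _)

theorem ramp_eq_one {M j : ℕ} {t : unitInterval} (h : (j : ℝ) + 1 ≤ M * t) : ramp M j t = 1 := by
  rw [ramp_apply, min_eq_left (by linarith), max_eq_right zero_le_one]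

theorem ramp_eq_zero {M j : ℕ} {t : unitInterval} (h : (M * t : ℝ) ≤ j) : ramp M j t = 0 := by
  rw [ramp_apply, max_eq_left]
  exact (min_le_right _ _).trans (by linarith)

theorem ramp_succ_le (M j : ℕ) (t : unitInterval) : ramp M (j + 1) t ≤ ramp M j t := by
  rw [ramp_apply, ramp_apply]
  push_cast
  gcongr
  linarith

/-- The positive contraction `t ↦ diag(1, …, 1, 1 - ramp M j t)`. -/
noncomputable def rampElement (n k M : ℕ) (j : Fin M) : RazakBlock n k :=
  RazakBlock.lift (1 - ramp M j) (by simp [ramp_eq_zero]) (by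
    have : ((j : ℕ) : ℝ) + 1 ≤ M := by exact_mod_cast j.2
    simp [ramp_eq_one, this]) 1

theorem trace_rampElement (M : ℕ) (j : Fin M) (t : unitInterval) :
    ((rampElement n k M j).1 t).trace = ((k * n - k * ramp M j t : ℝ) : ℂ) := by
  obtain ⟨m, rfl⟩ : ∃ m, n = m + 1 := Nat.exists_eq_succ_of_ne_zero (NeZero.ne n)
  rw [rampElement, RazakBlock.lift_apply, Matrix.trace_blockDiagonal, Fin.sum_univ_castSucc]
  simp [Matrix.trace_smul]
  ring

/-- Since the total dimension is kna + kb + c, the trace equals that dimension minus (c + k Σ ramp):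
the ramps measure tail counts, with the zero block as mass at 1. -/
theorem trace_stdRep_rampElement {a b c : ℕ} (s : Fin a → unitInterval) (M : ℕ) (j : Fin M) :
    (stdRep (n := n) (k := k) s (Fin b) (Fin c) (rampElement n k M j)).trace.re =
      k * n * a + k * b - k * ∑ x, ramp M j (s x) := by
  rw [trace_stdRep, rampElement, RazakBlock.inftyRep_lift, ← rampElement]
  simp only [trace_rampElement]
  rw [← Complex.ofReal_sum]
  simp [Finset.mul_sum]
  ring

theorem tailLE_of_trace_le {a b c a' b' c' : ℕ} {s : Fin a → unitInterval}
    {s' : Fin a' → unitInterval} (hdim : k * n * a + (k * b + c) = k * n * a' + (k * b' + c'))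
    {M : ℕ} (hM : 2 ≤ M) (h : ∀ i j : Fin M, (j : ℕ) = i + 1 →
      (stdRep (n := n) (k := k) s' (Fin b') (Fin c') (rampElement n k M i)).trace.re ≤
        (stdRep (n := n) (k := k) s (Fin b) (Fin c) (rampElement n k M j)).trace.re) :
    TailLE k M s c s' c' := by
  intro z v hz hzM hzv
  have hM0 : (0 : ℝ) < M := by exact_mod_cast (by omega : 0 < M)
  -- Ramp i vanishes on [0, z], and ramp i+1 equals 1 from (i+2)/M < z + 3/M onwards. The bound z ≤
  -- 1 - 2/M keeps i+1 a valid index.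
  let i := ⌈M * z⌉₊
  have hi1 : (M : ℝ) * z ≤ i := Nat.le_ceil _
  have hi2 : (i : ℝ) < M * z + 1 := Nat.ceil_lt_add_one (by positivity)
  have hi3 : i + 1 < M := by
    have h1 : (M : ℝ) * z ≤ ((M - 2 : ℕ) : ℝ) := by
      rw [Nat.cast_sub hM]
      calc (M : ℝ) * z ≤ M * (1 - 2 / M) := by gcongr
        _ = M - (2 : ℕ) := by field_simp; push_cast; ring
    have := Nat.ceil_le.2 h1
    omega
  have h1 := h ⟨i, by omega⟩ ⟨i + 1, hi3⟩ rfl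
  rw [trace_stdRep_rampElement, trace_stdRep_rampElement] at h1
  have h2 : ((Finset.univ.filter fun x => v ≤ (s x : ℝ)).card : ℝ) ≤
      ∑ x, ramp M (i + 1) (s x) := by
    rw [Finset.card_filter, Nat.cast_sum]
    refine Finset.sum_le_sum fun x _ => ?_
    split_ifs with hx
    · rw [ramp_eq_one, Nat.cast_one]
      have h3 : (M : ℝ) * (z + 3 / M) ≤ M * s x := by gcongr; linarith
      have h4 : (M : ℝ) * (z + 3 / M) = M * z + 3 := by field_simp
      push_cast
      linarith
    · simpa using ramp_nonneg _ _ _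
  have h3 : ∑ x, ramp M i (s' x) ≤ ((Finset.univ.filter fun x => z < (s' x : ℝ)).card : ℝ) := by
    rw [Finset.card_filter, Nat.cast_sum]
    refine Finset.sum_le_sum fun x _ => ?_
    split_ifs with hx
    · simpa using ramp_le_one _ _ _
    · rw [ramp_eq_zero, Nat.cast_zero]
      have h3 : (M : ℝ) * s' x ≤ M * z := by gcongr; linarith
      linarith
  have hdim' : (k * n * a + (k * b + c) : ℝ) = k * n * a' + (k * b' + c') := by exact_mod_cast hdim
  have h4 := mul_le_mul_of_nonneg_left h2 (Nat.cast_nonneg (α := ℝ) k)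
  have h5 := mul_le_mul_of_nonneg_left h3 (Nat.cast_nonneg (α := ℝ) k)
  have h6 : (c + k * (Finset.univ.filter fun x => v ≤ (s x : ℝ)).card : ℝ) ≤
      c' + k * (Finset.univ.filter fun x => z < (s' x : ℝ)).card := by
    simp only at h1
    linarith
  exact_mod_cast h6

theorem uNear_of_trace_le {ι ι' : Type} [Fintype ι] [DecidableEq ι] [Fintype ι'] [DecidableEq ι']
    (π : RazakBlock n k →⋆ₙₐ[ℂ] Matrix ι ι ℂ) (ρ : RazakBlock n k →⋆ₙₐ[ℂ] Matrix ι' ι' ℂ)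
    (hcard : Fintype.card ι = Fintype.card ι') {M : ℕ} (hM : 2 ≤ M)
    (h : ∀ i j : Fin M, (j : ℕ) = i + 1 →
      (ρ (rampElement n k M i)).trace.re ≤ (π (rampElement n k M j)).trace.re)
    (h' : ∀ i j : Fin M, (j : ℕ) = i + 1 →
      (π (rampElement n k M i)).trace.re ≤ (ρ (rampElement n k M j)).trace.re)
    (G : Set (RazakBlock n k)) {ε : ℝ} (hε : 0 ≤ ε)
    (hG : ∀ f ∈ G, ∀ t t' : unitInterval, |(t : ℝ) - t'| ≤ 5 / M → ‖f.1 t - f.1 t'‖ ≤ ε) :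
    UNear G (3 * ε) π ρ := by
  obtain ⟨a, b, c, s, hs, hu⟩ := exists_uEquiv_stdRep π
  obtain ⟨a', b', c', s', hs', hu'⟩ := exists_uEquiv_stdRep ρ
  have hdim : k * n * a + (k * b + c) = k * n * a' + (k * b' + c') := by
    have h1 := hu.card_eq
    have h2 := hu'.card_eq
    simp at h1 h2
    omega
  simp only [hu.trace_eq, hu'.trace_eq] at h h'
  have h3 := uNear_stdRep_of_tailLE (by exact_mod_cast hM) hdim
    (tailLE_of_trace_le hdim hM h) (tailLE_of_trace_le hdim.symm hM h') G hε hG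
  have := ((hu.uNear G).trans h3).trans (hu'.symm.uNear G)
  simpa using this

/-- The element is $yy^*$ with $y = \sqrt h\,D \neq 0$, so faithfulness and positivity apply. -/
theorem bump_sq_pos {σ : RazakBlock n k →L[ℂ] ℂ} (hσ : IsFaithfulDiffuseTrace σ)
    (h : C(unitInterval, ℝ)) (h0 : h 0 = 0) (h1 : h 1 = 0) (hpos : ∀ t, 0 ≤ h t)
    {t : unitInterval} (ht : h t ≠ 0) (D : Matrix (Fin k × Fin n) (Fin k × Fin n) ℂ)
    (hD : D * star D = D) (hD0 : D ≠ 0) : 0 < (σ (RazakBlock.bump h h0 h1 D)).re := by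
  let g : C(unitInterval, ℝ) := ⟨fun t => √(h t), by fun_prop⟩
  let y : RazakBlock n k := RazakBlock.bump g (by simp [g, h0]) (by simp [g, h1]) D
  have hy : y * star y = RazakBlock.bump h h0 h1 D := RazakBlock.ext_apply fun s => by
    change ((√(h s) : ℝ) : ℂ) • D * star (((√(h s) : ℝ) : ℂ) • D) = (h s : ℂ) • D
    rw [star_smul, Matrix.smul_mul, Matrix.mul_smul, hD, smul_smul]
    congr 1
    simp only [RCLike.star_def, Complex.conj_ofReal]
    rw [← Complex.ofReal_mul, Real.mul_self_sqrt (hpos s)]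
  have hy0 : y ≠ 0 := fun hy0 => by
    have h2 : y.1 t = 0 := by rw [hy0]; rfl
    have h3 : ((√(h t) : ℝ) : ℂ) • D = 0 := h2
    rw [smul_eq_zero] at h3
    rcases h3 with h3 | h3
    · rw [Complex.ofReal_eq_zero, Real.sqrt_eq_zero (hpos t)] at h3
      exact ht h3
    · exact hD0 h3
  have h4 : σ (y * star y) ≠ 0 := fun h => hy0 ((hσ.faithful y).1 h)
  have h5 : 0 ≤ σ (y * star y) := by
    have := hσ.isTrace.nonneg (star y)
    rwa [star_star] at this
  rw [← hy]
  exact (Complex.pos_iff.1 (lt_of_le_of_ne h5 h4.symm)).1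

/-- The difference is (ramp i - ramp j) times the projection D onto the last diagonal block: a
nonnegative function, nonzero at (i+1)/M, times a nonzero projection. -/
theorem rampElement_lt {σ : RazakBlock n k →L[ℂ] ℂ} (hσ : IsFaithfulDiffuseTrace σ) {M : ℕ}
    {i j : Fin M} (hij : (j : ℕ) = i + 1) :
    (σ (rampElement n k M i)).re < (σ (rampElement n k M j)).re := by
  have hM : (0 : ℝ) < M := by exact_mod_cast (by omega : 0 < M)
  have hi1 : ((i : ℕ) : ℝ) + 1 ≤ M := by exact_mod_cast i.2
  have hj1 : ((j : ℕ) : ℝ) + 1 ≤ M := by exact_mod_cast j.2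
  let D : Matrix (Fin k × Fin n) (Fin k × Fin n) ℂ :=
    Matrix.blockDiagonal fun l : Fin n => if (l : ℕ) + 1 < n then 0 else 1
  have hD : D * star D = D := by
    rw [Matrix.star_eq_conjTranspose, Matrix.blockDiagonal_conjTranspose,
      ← Matrix.blockDiagonal_mul]
    congr 1
    funext l
    split_ifs <;> simp
  have hD0 : D ≠ 0 := fun h => by
    have h1 := congrFun (congrFun h (0, ⟨n - 1, Nat.sub_lt (NeZero.pos n) one_pos⟩))
      (0, ⟨n - 1, Nat.sub_lt (NeZero.pos n) one_pos⟩)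
    have h2 : ¬ (n - 1 + 1 < n) := by omega
    simp [D, h2] at h1
  have key := bump_sq_pos hσ (ramp M i - ramp M j) (by simp [ramp_eq_zero])
    (by simp [ramp_eq_one, hi1, hj1]) (fun t => by
      rw [ContinuousMap.sub_apply, hij]
      exact sub_nonneg.2 (ramp_succ_le _ _ _))
    (t := ⟨(i + 1) / M, by positivity, (div_le_one hM).2 hi1⟩) (by
      rw [ContinuousMap.sub_apply, ramp_eq_one (by field_simp; exact le_rfl),
        ramp_eq_zero (by rw [hij]; field_simp; push_cast; exact le_rfl)]
      norm_num) D hD hD0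
  have e : RazakBlock.bump (ramp M i - ramp M j) (by simp [ramp_eq_zero])
      (by simp [ramp_eq_one, hi1, hj1]) D = rampElement n k M j - rampElement n k M i := by
    refine RazakBlock.ext_apply fun t => ?_
    change ((ramp M i t - ramp M j t : ℝ) : ℂ) • D =
      (rampElement n k M j).1 t - (rampElement n k M i).1 t
    rw [rampElement, rampElement, RazakBlock.lift_apply, RazakBlock.lift_apply,
      ← Matrix.blockDiagonal_sub, ← Matrix.blockDiagonal_smul]
    congr 1
    funext l
    simp only [Pi.smul_apply, Pi.sub_apply]
    split_ifs
    · simp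
    · rw [← sub_smul]
      simp
  rw [e, map_sub, Complex.sub_re] at key
  linarith

theorem normTrace_apply (ι : Type) [Fintype ι] [DecidableEq ι] (a : Matrix ι ι ℂ) :
    normTrace ι a = (Fintype.card ι : ℂ)⁻¹ * a.trace := rfl

/-- Two representations whose normalised traces are close to a given faithful diffuse trace are
approximately unitarily equivalent. -/
theorem exists_uNear_of_trace_close {σ : RazakBlock n k →L[ℂ] ℂ} (hσ : IsFaithfulDiffuseTrace σ)
    (G : Set (RazakBlock n k)) (hG : G.Finite) {ε : ℝ} (hε : 0 < ε) :
    ∃ F : Set (RazakBlock n k), F.Finite ∧ ∃ δ > 0, ∀ (ι : Type) [Fintype ι] [DecidableEq ι]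
      [Nonempty ι] (π ρ : RazakBlock n k →⋆ₙₐ[ℂ] Matrix ι ι ℂ),
      (∀ f ∈ F, ‖normTrace ι (π f) - σ f‖ ≤ δ) → (∀ f ∈ F, ‖normTrace ι (ρ f) - σ f‖ ≤ δ) →
      UNear G ε π ρ := by
  obtain ⟨M, hM, hM2⟩ := (((Filter.eventually_all_finite hG).2 fun f _ =>
    eventually_norm_sub_le f.1 5 (show 0 < ε / 3 by positivity)).and
      (Filter.eventually_ge_atTop 2)).exists
  -- Half the jump of σ between consecutive ramps; if both traces are within the minimum of these
  -- gaps of σ, their order along consecutive ramps is preserved. The value 1 on other pairs only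
  -- keeps the minimum positive.
  let gap : Fin M × Fin M → ℝ := fun p => if (p.2 : ℕ) = p.1 + 1 then
    ((σ (rampElement n k M p.2)).re - (σ (rampElement n k M p.1)).re) / 2 else 1
  have hgap : ∀ p, 0 < gap p := fun p => by
    simp only [gap]
    split_ifs with hp
    · exact half_pos (sub_pos.2 (rampElement_lt hσ hp))
    · exact one_pos
  have : NeZero M := ⟨by omega⟩
  obtain ⟨p₀, hp₀⟩ := Finite.exists_min gap
  refine ⟨Set.range (rampElement n k M), Set.finite_range _, gap p₀, hgap p₀, ?_⟩
  intro ι _ _ _ π ρ hπ hρ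
  have hc : (0 : ℝ) < Fintype.card ι := by exact_mod_cast Fintype.card_pos
  have key : ∀ π ρ : RazakBlock n k →⋆ₙₐ[ℂ] Matrix ι ι ℂ,
      (∀ f ∈ Set.range (rampElement n k M), ‖normTrace ι (π f) - σ f‖ ≤ gap p₀) →
      (∀ f ∈ Set.range (rampElement n k M), ‖normTrace ι (ρ f) - σ f‖ ≤ gap p₀) →
      ∀ i j : Fin M, (j : ℕ) = i + 1 →
        (ρ (rampElement n k M i)).trace.re ≤ (π (rampElement n k M j)).trace.re := by
    intro π ρ hπ hρ i j hij
    have hre : ∀ a : Matrix ι ι ℂ,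
        (normTrace ι a).re = (Fintype.card ι : ℝ)⁻¹ * a.trace.re := fun a => by
      rw [normTrace_apply, ← Complex.ofReal_natCast, ← Complex.ofReal_inv, Complex.re_ofReal_mul]
    have h1 := (Complex.abs_re_le_norm _).trans (hπ _ ⟨j, rfl⟩)
    have h2 := (Complex.abs_re_le_norm _).trans (hρ _ ⟨i, rfl⟩)
    have h3 := hp₀ (i, j)
    rw [Complex.sub_re, hre, abs_le] at h1 h2
    simp only [gap, hij] at h3
    refine le_of_mul_le_mul_left ?_ (inv_pos.2 hc)
    simp only [if_true] at h3
    simp only [gap] at h1 h2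
    linarith [h1.1, h2.2]
  have := uNear_of_trace_le π ρ rfl hM2 (key π ρ hπ hρ) (key ρ π hρ hπ) G (ε := ε / 3)
    (by positivity) hM
  convert this using 1
  ring

end Uniqueness

/-! ### Quantile functions of faithful diffuse traces -/

section Quantile

variable {n k : ℕ} [NeZero n] [NeZero k]

theorem measureTrace_apply (n k : ℕ) (μ : Measure unitInterval) [IsFiniteMeasure μ]
    (f : RazakBlock n k) :
    measureTrace n k μ f = ∫ t, normTrace (Fin k × Fin n) (f.1 t) ∂μ := rfl

/-- On a null interval, a nonzero nonnegative bump supported there would have trace 0, against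
faithfulness. -/
theorem measure_Ioc_ne_zero {μ : Measure unitInterval} [IsFiniteMeasure μ]
    (hτ : IsFaithfulDiffuseTrace (measureTrace n k μ)) {a b : unitInterval} (hab : a < b) :
    μ (Set.Ioc a b) ≠ 0 := by
  intro hμ
  have hab' : (a : ℝ) < b := hab
  let h : C(unitInterval, ℝ) := ⟨fun t => max 0 (((t : ℝ) - a) * (b - t)), by fun_prop⟩
  have hout : ∀ t, t ∉ Set.Ioc a b → h t = 0 := fun t ht => by
    refine max_eq_left ?_
    rw [Set.mem_Ioc, not_and_or, not_lt, not_le] at ht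
    rcases ht with ht | ht
    · have ht' : (t : ℝ) ≤ a := ht
      nlinarith
    · have ht' : (b : ℝ) < t := ht
      nlinarith
  have h0 : h 0 = 0 := hout 0 fun h => not_lt_bot h.1
  have h1 : h 1 = 0 := by
    refine max_eq_left ?_
    have := a.2.2
    have := b.2.2
    rw [Set.Icc.coe_one]
    nlinarith
  let c : unitInterval := ⟨((a : ℝ) + b) / 2, by have := a.2.1; have := b.2.1; linarith, by
    have := a.2.2; have := b.2.2; linarith⟩
  have hc : h c ≠ 0 := by
    have h2 : 0 < ((c : ℝ) - a) * (b - c) :=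
      mul_pos (by simp only [c]; linarith) (by simp only [c]; linarith)
    exact (lt_max_of_lt_right h2).ne'
  have key := bump_sq_pos hτ h h0 h1 (fun t => le_max_left _ _) hc 1 (by simp) one_ne_zero
  rw [measureTrace_apply, integral_eq_zero_of_ae] at key
  · simp at key
  · refine (measure_eq_zero_iff_ae_notMem.1 hμ).mono fun t ht => ?_
    change normTrace _ ((h t : ℂ) • 1) = 0
    rw [hout t ht]
    simp

/-- The distribution function is continuous because μ has no atoms and strictly increasing because
intervals have positive mass. It is therefore an order isomorphism of [0,1], and its inverse Q
carries Lebesgue measure to μ. -/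
theorem exists_quantile {μ : Measure unitInterval} [IsProbabilityMeasure μ]
    (hat : ∀ t, μ {t} = 0) (hpos : ∀ a b : unitInterval, a < b → μ (Set.Ioc a b) ≠ 0) :
    ∃ Q : C(unitInterval, unitInterval), Q 0 = 0 ∧ Q 1 = 1 ∧
      (volume : Measure unitInterval).map Q = μ := by
  let F : unitInterval → unitInterval := fun t => ⟨μ.real (Set.Iic t), measureReal_nonneg,
    measureReal_le_one⟩
  have hF0 : F 0 = 0 := Subtype.ext (by
    have : Set.Iic (0 : unitInterval) = {0} := Set.Iic_bot
    simp [F, this, Measure.real, hat])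
  have hF1 : F 1 = 1 := Subtype.ext (by
    have : Set.Iic (1 : unitInterval) = Set.univ := Set.Iic_top
    simp [F, this])
  have hFmono : StrictMono F := fun a b hab => by
    change μ.real (Set.Iic a) < μ.real (Set.Iic b)
    rw [← Set.Iic_union_Ioc_eq_Iic hab.le, measureReal_union
      (Set.Iic_disjoint_Ioc le_rfl) measurableSet_Ioc]
    have := (measureReal_nonneg (μ := μ) (s := Set.Ioc a b)).lt_of_ne'
      ((measureReal_ne_zero_iff).2 (hpos a b hab))
    linarith
  have hFcont : Continuous F := by
    refine Continuous.subtype_mk ?_ _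
    have e : ∀ t, μ.real (Set.Iic t) = ∫ s, (Set.Iic t).indicator (fun _ => (1 : ℝ)) s ∂μ :=
      fun t => (integral_indicator_one measurableSet_Iic).symm
    simp only [e]
    refine continuous_iff_continuousAt.2 fun t₀ => ?_
    refine continuousAt_of_dominated (bound := fun _ => 1)
      (Filter.Eventually.of_forall fun t =>
        (measurable_const.indicator measurableSet_Iic).aestronglyMeasurable)
      (Filter.Eventually.of_forall fun t => Filter.Eventually.of_forall fun s => ?_)
      (integrable_const _) ?_
    · rw [Set.indicator_apply]
      split_ifs <;> simp
    · refine (measure_eq_zero_iff_ae_notMem.1 (hat t₀)).mono fun s hs => ?_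
      rcases lt_or_gt_of_ne (show s ≠ t₀ from hs) with h | h
      · refine (continuousAt_const (y := (1 : ℝ))).congr ?_
        filter_upwards [lt_mem_nhds h] with t ht
        simp [ht.le]
      · refine (continuousAt_const (y := (0 : ℝ))).congr ?_
        filter_upwards [gt_mem_nhds h] with t ht
        simp [ht]
  have hFsurj : Function.Surjective F := fun y =>
    mem_range_of_exists_le_of_exists_ge hFcont ⟨0, hF0.le.trans bot_le⟩ ⟨1, le_top.trans hF1.ge⟩
  let e := hFmono.orderIsoOfSurjective F hFsurj
  have he : ∀ t, e t = F t := fun t => rfl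
  refine ⟨⟨e.symm, e.symm.continuous⟩, ?_, ?_, ?_⟩
  · exact e.symm_apply_eq.2 hF0.symm
  · exact e.symm_apply_eq.2 hF1.symm
  · have : IsFiniteMeasure ((volume : Measure unitInterval).map e.symm) :=
      Measure.isFiniteMeasure_map _ _
    refine Measure.ext_of_Iic _ _ fun t => ?_
    rw [Measure.map_apply (map_continuous _).measurable measurableSet_Iic]
    have hpre : (⇑(⟨e.symm, e.symm.continuous⟩ : C(unitInterval, unitInterval))) ⁻¹' Set.Iic t =
        Set.Iic (F t) := by
      ext s
      exact e.symm_apply_le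
    rw [hpre, unitInterval.volume_Iic]
    exact ofReal_measureReal

theorem IsFaithfulDiffuseTrace.exists_quantile {τ : RazakBlock n k →L[ℂ] ℂ}
    (hτ : IsFaithfulDiffuseTrace τ) : ∃ Q : C(unitInterval, unitInterval), Q 0 = 0 ∧ Q 1 = 1 ∧
      ∀ f, τ f = ∫ t, normTrace (Fin k × Fin n) (f.1 (Q t)) := by
  obtain ⟨μ, hμ, hat, rfl⟩ := hτ.diffuse
  obtain ⟨Q, h0, h1, hQ⟩ := _root_.exists_quantile hat fun a b hab => measure_Ioc_ne_zero hτ hab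
  refine ⟨Q, h0, h1, fun f => ?_⟩
  rw [measureTrace_apply]
  conv_lhs => rw [← hQ]
  refine integral_map (map_continuous Q).aemeasurable ?_
  exact ((normTrace (Fin k × Fin n)).continuous.comp (map_continuous f.1)).aestronglyMeasurable

end Quantile

/-! ### Connectedness of the unitary group -/

section UnitaryPath

variable {ι : Type} [Fintype ι] [DecidableEq ι]

/-- Multiplication by a scalar of modulus one, as a unitary matrix. -/
noncomputable def scalarUnitary (ι : Type) [Fintype ι] [DecidableEq ι] (z : Circle) :
    unitary (Matrix ι ι ℂ) :=
  ⟨(z : ℂ) • 1, by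
    rw [Unitary.mem_iff]
    constructor <;> simp [smul_smul, Complex.mul_conj, Complex.conj_mul',
      Circle.norm_coe]⟩

theorem continuous_scalarUnitary : Continuous (scalarUnitary ι) :=
  Continuous.subtype_mk (by fun_prop) _

/-- Choose z on the circle off the finite spectrum of u. Then $-z^{-1}u$ omits the spectral value
-1, so it lies at distance less than 2 from 1 and is joined to it; the remaining scalar -z moves
within the circle. -/
theorem joined_one_unitary (u : unitary (Matrix ι ι ℂ)) : Joined 1 u := by
  have hinf : (Set.univ : Set Circle).Infinite :=
    isPreconnected_univ.infinite_of_nontrivial ⟨1, trivial, -1, trivial, fun h => by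
      have h1 : ((1 : Circle) : ℂ) = ((-1 : Circle) : ℂ) := by rw [← h]
      norm_num at h1⟩
  obtain ⟨z, -, hz⟩ := (hinf.sdiff ((Matrix.finite_spectrum (u : Matrix ι ι ℂ)).preimage
    (Circle.coe_injective.injOn ))).nonempty
  have hz' : (z : ℂ) ∉ spectrum ℂ (u : Matrix ι ι ℂ) := hz
  have hz0 : (z : ℂ) ≠ 0 := Circle.coe_ne_zero z
  let w : unitary (Matrix ι ι ℂ) := scalarUnitary ι (-z⁻¹) * u
  have hw : Joined 1 w := by
    refine Unitary.joined 1 w ((Unitary.norm_sub_one_lt_two_iff w.2).2 ?_)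
    rw [spectrum.notMem_iff] at hz' ⊢
    have e : algebraMap ℂ (Matrix ι ι ℂ) (-1) - (w : Matrix ι ι ℂ) =
        (Units.mk0 (-(z : ℂ)⁻¹) (neg_ne_zero.2 (inv_ne_zero hz0))) •
          (algebraMap ℂ (Matrix ι ι ℂ) z - u) := by
      simp [w, scalarUnitary, Algebra.algebraMap_eq_smul_one, Units.smul_def, smul_sub, smul_smul,
        hz0]
    rw [e]
    exact hz'.smul _
  have hs : Joined 1 (scalarUnitary ι (-z)) := by
    have h1 : scalarUnitary ι 1 = 1 := Subtype.ext (by simp [scalarUnitary])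
    rw [← h1]
    exact ⟨(PathConnectedSpace.joined 1 (-z)).somePath.map continuous_scalarUnitary⟩
  have h2 := hs.mul hw
  have h3 : scalarUnitary ι (-z) * w = u := Subtype.ext (by
    simp [w, scalarUnitary, smul_smul, hz0])
  rwa [h3, one_mul] at h2

end UnitaryPath

/-! ### Cells, tents and their integrals -/

section CellPaths

/-- The affine map of the unit interval onto its `j`-th subinterval of length `1 / L`. -/
noncomputable def cellMap (L j : ℕ) : C(unitInterval, unitInterval) :=
  ⟨fun t => Set.projIcc 0 1 zero_le_one ((L : ℝ)⁻¹ * t + j / L), by fun_prop⟩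

/-- The tent map of the unit interval. -/
noncomputable def tentMap : C(unitInterval, unitInterval) :=
  ⟨fun t => Set.projIcc 0 1 zero_le_one (1 - |2 * (t : ℝ) - 1|), by fun_prop⟩

/-- The grid point `j / L` of the unit interval. -/
noncomputable def gridPoint (L j : ℕ) : unitInterval := Set.projIcc 0 1 zero_le_one (j / L : ℝ)

theorem cellMap_zero (L j : ℕ) : cellMap L j 0 = gridPoint L j := by
  simp [cellMap, gridPoint]

theorem cellMap_one (L j : ℕ) : cellMap L j 1 = gridPoint L (j + 1) := by
  simp only [cellMap, gridPoint, ContinuousMap.coe_mk]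
  congr 1
  push_cast
  ring

theorem gridPoint_zero (L : ℕ) : gridPoint L 0 = 0 := by
  simp [gridPoint]

theorem gridPoint_self {L : ℕ} (hL : 0 < L) : gridPoint L L = 1 := by
  have : (L : ℝ) ≠ 0 := by exact_mod_cast hL.ne'
  simp [gridPoint, this]

theorem tentMap_zero : tentMap 0 = 0 := by
  simp [tentMap]

theorem tentMap_one : tentMap 1 = 0 := by
  simp only [tentMap, ContinuousMap.coe_mk]
  norm_num

theorem cellMap_dist (L j : ℕ) (s t : unitInterval) :
    |(cellMap L j s : ℝ) - cellMap L j t| ≤ 1 / L := by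
  refine (Set.abs_projIcc_sub_projIcc zero_le_one).trans ?_
  rw [add_sub_add_right_eq_sub, ← mul_sub, abs_mul, abs_of_nonneg (by positivity), one_div]
  refine mul_le_of_le_one_right (by positivity) ?_
  rw [abs_le]
  constructor <;> linarith [s.2.1, s.2.2, t.2.1, t.2.2]

theorem integral_unitInterval_eq (h : C(unitInterval, ℂ)) :
    ∫ t, h t = ∫ t in (0 : ℝ)..1, Set.IccExtend zero_le_one h t := by
  rw [intervalIntegral.integral_of_le zero_le_one, ← integral_Icc_eq_integral_Ioc,
    ← integral_subtype_comap measurableSet_Icc]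
  refine integral_congr_ae (Filter.Eventually.of_forall fun t => ?_)
  exact (Set.IccExtend_val _ _ t).symm

theorem sum_integral_cellMap {L : ℕ} (hL : 0 < L) (h : C(unitInterval, ℂ)) :
    ∑ j ∈ Finset.range L, ∫ t, h (cellMap L j t) = L * ∫ t, h t := by
  have hL0 : (L : ℝ) ≠ 0 := by exact_mod_cast hL.ne'
  have hcont : Continuous (Set.IccExtend (zero_le_one (α := ℝ)) h) := by fun_prop
  have e : ∀ j ∈ Finset.range L, ∫ t, h (cellMap L j t) =
      (L : ℂ) * ∫ t in ((j : ℕ) / L : ℝ)..((j + 1 : ℕ) / L : ℝ),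
        Set.IccExtend zero_le_one h t := by
    intro j _
    refine (integral_unitInterval_eq (h.comp (cellMap L j))).trans ?_
    have h1 : ∫ t in (0 : ℝ)..1, Set.IccExtend zero_le_one (h.comp (cellMap L j)) t =
        ∫ t in (0 : ℝ)..1, Set.IccExtend zero_le_one h ((L : ℝ)⁻¹ * t + j / L) := by
      refine intervalIntegral.integral_congr fun t ht => ?_
      rw [Set.uIcc_of_le zero_le_one] at ht
      rw [Set.IccExtend_of_mem _ _ ht]
      rfl
    rw [h1, intervalIntegral.integral_comp_mul_add _ (inv_ne_zero hL0), inv_inv]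
    have h2 : (L : ℝ)⁻¹ * 0 + j / L = j / L := by ring
    have h3 : (L : ℝ)⁻¹ * 1 + j / L = (j + 1 : ℕ) / L := by push_cast; ring
    rw [h2, h3]
    simp
  rw [Finset.sum_congr rfl e, ← Finset.mul_sum,
    intervalIntegral.sum_integral_adjacent_intervals (a := fun j => ((j : ℕ) / L : ℝ))
      fun j _ => hcont.intervalIntegrable _ _, integral_unitInterval_eq]
  simp [hL0]

/-- The tent map preserves Lebesgue measure: each half of the interval covers [0,1] once, at speed
2. -/
theorem integral_tentMap (h : C(unitInterval, ℂ)) : ∫ t, h (tentMap t) = ∫ t, h t := by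
  have hcont : Continuous (Set.IccExtend (zero_le_one (α := ℝ)) h) := by fun_prop
  refine (integral_unitInterval_eq (h.comp tentMap)).trans ?_
  have hcont' : Continuous (Set.IccExtend (zero_le_one (α := ℝ)) (h.comp tentMap)) := by fun_prop
  rw [← intervalIntegral.integral_add_adjacent_intervals (b := 1 / 2)
    (hcont'.intervalIntegrable _ _) (hcont'.intervalIntegrable _ _), integral_unitInterval_eq]
  have h1 : ∫ t in (0 : ℝ)..(1 / 2), Set.IccExtend zero_le_one (h.comp tentMap) t =
      ∫ t in (0 : ℝ)..(1 / 2), Set.IccExtend zero_le_one h (2 * t) := by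
    refine intervalIntegral.integral_congr fun t ht => ?_
    rw [Set.uIcc_of_le (by norm_num)] at ht
    rw [Set.IccExtend_of_mem _ _ ⟨ht.1, by linarith [ht.2]⟩]
    change h (Set.projIcc 0 1 zero_le_one (1 - |2 * t - 1|)) = _
    rw [abs_of_nonpos (by linarith [ht.2])]
    change _ = h (Set.projIcc 0 1 zero_le_one (2 * t))
    congr 2
    ring
  have h2 : ∫ t in (1 / 2 : ℝ)..1, Set.IccExtend zero_le_one (h.comp tentMap) t =
      ∫ t in (1 / 2 : ℝ)..1, Set.IccExtend zero_le_one h (2 - 2 * t) := by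
    refine intervalIntegral.integral_congr fun t ht => ?_
    rw [Set.uIcc_of_le (by norm_num)] at ht
    rw [Set.IccExtend_of_mem _ _ ⟨by linarith [ht.1], ht.2⟩]
    change h (Set.projIcc 0 1 zero_le_one (1 - |2 * t - 1|)) = _
    rw [abs_of_nonneg (by linarith [ht.1])]
    change _ = h (Set.projIcc 0 1 zero_le_one (2 - 2 * t))
    congr 2
    ring
  rw [h1, h2, intervalIntegral.integral_comp_mul_left _ two_ne_zero,
    intervalIntegral.integral_comp_sub_mul _ two_ne_zero]
  norm_num
  ring

end CellPaths

/-! ### Reindexing -/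

section Reindex

variable {A : Type*} [NonUnitalCStarAlgebra A]
variable {ι ι' : Type} [Fintype ι] [DecidableEq ι] [Fintype ι'] [DecidableEq ι']

/-- Transport of a representation along a bijection of index types. -/
def reindexRep (e : ι ≃ ι') (π : A →⋆ₙₐ[ℂ] Matrix ι ι ℂ) : A →⋆ₙₐ[ℂ] Matrix ι' ι' ℂ where
  toFun f := (π f).submatrix e.symm e.symm
  map_smul' c f := by rw [map_smul]; rfl
  map_zero' := by rw [map_zero]; rfl
  map_add' f g := by rw [map_add]; rfl
  map_mul' f g := by rw [map_mul, Matrix.submatrix_mul_equiv]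
  map_star' f := by
    rw [map_star, Matrix.star_eq_conjTranspose, Matrix.star_eq_conjTranspose,
      Matrix.conjTranspose_submatrix]

theorem trace_reindexRep (e : ι ≃ ι') (π : A →⋆ₙₐ[ℂ] Matrix ι ι ℂ) (f : A) :
    (reindexRep e π f).trace = (π f).trace :=
  Equiv.sum_comp e.symm fun i => π f i i

end Reindex

/-! ### Trace preserving maps with nearly constant fibre traces -/

section Existence

variable {n k : ℕ} [NeZero n] [NeZero k]

/-- The number of rising paths in the `j`-th cell. -/
def risingCount (n L j : ℕ) : ℕ := (n - 1) * L + 1 + j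

/-- Abel summation: the count grows by 1 from cell to cell, which leaves minus the sum of the T j
and boundary terms. -/
theorem sum_risingCount_mul_sub (n L : ℕ) (T : ℕ → ℂ) (l : ℕ) :
    ∑ j ∈ Finset.range l, (risingCount n L j : ℂ) * (T (j + 1) - T j) =
      ((n - 1 : ℕ) * L + l) * T l - (n - 1 : ℕ) * L * T 0 - ∑ j ∈ Finset.range l, T j := by
  induction l with
  | zero => simp
  | succ l ih =>
    rw [Finset.sum_range_succ, ih, Finset.sum_range_succ, risingCount]
    push_cast
    ring

theorem sum_fin_ite {N m : ℕ} (hm : m ≤ N) (x y : ℂ) :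
    (∑ i : Fin N, if (i : ℕ) < m then x else y) = m * x + (N - m) * y := by
  obtain ⟨d, rfl⟩ := Nat.exists_eq_add_of_le hm
  rw [Fin.sum_univ_add]
  simp

/-- The path followed by the `i`-th copy of the `j`-th cell: it rises through the cell if `i` is
small, and otherwise goes up and down. -/
noncomputable def cellPath (n L j i : ℕ) : C(unitInterval, unitInterval) :=
  if i < risingCount n L j then cellMap L j else (cellMap L j).comp tentMap

theorem cellPath_zero (n L j i : ℕ) : cellPath n L j i 0 = gridPoint L j := by
  rw [cellPath]
  split_ifs
  · exact cellMap_zero L j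
  · rw [ContinuousMap.comp_apply, tentMap_zero, cellMap_zero]

theorem cellPath_one (n L j i : ℕ) : cellPath n L j i 1 =
    if i < risingCount n L j then gridPoint L (j + 1) else gridPoint L j := by
  rw [cellPath]
  split_ifs
  · exact cellMap_one L j
  · rw [ContinuousMap.comp_apply, tentMap_one, cellMap_zero]

theorem cellPath_dist (n L j i : ℕ) (s t : unitInterval) :
    |(cellPath n L j i s : ℝ) - cellPath n L j i t| ≤ 1 / L := by
  rw [cellPath]
  split_ifs <;> exact cellMap_dist _ _ _ _

theorem integral_cellPath (n L j i : ℕ) (h : C(unitInterval, ℂ)) :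
    ∫ t, h (cellPath n L j i t) = ∫ t, h (cellMap L j t) := by
  rw [cellPath]
  split_ifs
  · rfl
  · exact integral_tentMap (h.comp (cellMap L j))

/-- The block diagonal representation with blocks the evaluations at `Q (p i j)`. -/
noncomputable def gridRep {L N K : ℕ} (E : (Fin k × Fin n) × Fin L ≃ Fin K)
    (p : Fin N → Fin L → unitInterval) :
    RazakBlock n k →⋆ₙₐ[ℂ] Matrix (Fin K × Fin N) (Fin K × Fin N) ℂ :=
  blockRep fun i => reindexRep E (blockRep fun j => pointRep (p i j))

theorem trace_gridRep {L N K : ℕ} (E : (Fin k × Fin n) × Fin L ≃ Fin K)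
    (p : Fin N → Fin L → unitInterval) (f : RazakBlock n k) :
    (gridRep E p f).trace = ∑ i, ∑ j, (f.1 (p i j)).trace := by
  rw [gridRep, blockRep_apply, Matrix.trace_blockDiagonal]
  refine Finset.sum_congr rfl fun i _ => ?_
  rw [trace_reindexRep, blockRep_apply, Matrix.trace_blockDiagonal]
  rfl

theorem normTrace_gridRep {L N K : ℕ} (E : (Fin k × Fin n) × Fin L ≃ Fin K)
    (p : Fin N → Fin L → unitInterval) (f : RazakBlock n k) :
    normTrace (Fin K × Fin N) (gridRep E p f) =
      ((N : ℂ) * L)⁻¹ * ∑ i, ∑ j, normTrace (Fin k × Fin n) (f.1 (p i j)) := by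
  have hK : K = k * n * L := by simpa using (Fintype.card_congr E).symm
  simp only [normTrace_apply, trace_gridRep, ← Finset.mul_sum]
  rw [← mul_assoc, ← mul_inv, hK]
  congr 2
  simp
  ring

/-- Compare traces. The rising paths must lower the total of the N starting blocks by exactly one
block. Abel summation gives minus one block plus $nL\,T_L - (n-1)L\,T_0$; these boundary terms
cancel because $T_0 = n\,\mathrm{tr}\,a_f$ and $T_L = (n-1)\,\mathrm{tr}\,a_f$. The condition nL ≤ N
leaves room for all the rising paths. -/
theorem gridRep_one_uEquiv {L N K : ℕ} (hL : 0 < L) (hN : n * L ≤ N)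
    (E : (Fin k × Fin n) × Fin L ≃ Fin K) (Q : C(unitInterval, unitInterval)) (hQ0 : Q 0 = 0)
    (hQ1 : Q 1 = 1) :
    UEquiv (blockRep fun i : Fin N => if (i : ℕ) + 1 < N then
      reindexRep E (blockRep fun j : Fin L => pointRep (n := n) (k := k) (Q (gridPoint L j))) else 0)
      (gridRep E fun (i : Fin N) (j : Fin L) => Q (cellPath n L j i 1)) := by
  refine uEquiv_of_trace_eq _ _ rfl fun f => ?_
  have hn := NeZero.pos n
  have hN0 : 0 < N := (Nat.mul_pos hn hL).trans_le hN
  let T : ℕ → ℂ := fun j => (f.1 (Q (gridPoint L j))).trace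
  have hT0 : T 0 = n * (inftyRep f).trace := by
    simp only [T]
    rw [gridPoint_zero, hQ0, RazakBlock.trace_apply_zero]
  have hTL : T L = (n - 1) * (inftyRep f).trace := by
    simp only [T]
    rw [gridPoint_self hL, hQ1, RazakBlock.trace_apply_one]
  have hl : (blockRep (fun i : Fin N => if (i : ℕ) + 1 < N then
      reindexRep E (blockRep fun j : Fin L => pointRep (n := n) (k := k) (Q (gridPoint L j)))
        else 0) f).trace = (N - 1) * ∑ j ∈ Finset.range L, T j := by
    rw [blockRep_apply, Matrix.trace_blockDiagonal]
    have : ∀ i : Fin N, ((if (i : ℕ) + 1 < N then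
      reindexRep E (blockRep fun j : Fin L => pointRep (n := n) (k := k) (Q (gridPoint L j)))
        else 0) f).trace = if (i : ℕ) < N - 1 then ∑ j ∈ Finset.range L, T j else 0 := fun i => by
      by_cases hi : (i : ℕ) + 1 < N
      · rw [if_pos hi, if_pos (by omega), trace_reindexRep, blockRep_apply,
          Matrix.trace_blockDiagonal, Finset.sum_range]
        rfl
      · rw [if_neg hi, if_neg (by omega)]
        exact Matrix.trace_zero _ _
    rw [Finset.sum_congr rfl fun i _ => this i, sum_fin_ite (Nat.sub_le _ _),
      Nat.cast_sub hN0, mul_zero, add_zero, Nat.cast_one]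
  rw [hl, trace_gridRep, Finset.sum_comm]
  have hr : ∀ j : Fin L, ∑ i : Fin N, (f.1 (Q (cellPath n L j i 1))).trace =
      (risingCount n L j : ℂ) * (T (j + 1) - T j) + N * T j := fun j => by
    have h1 : risingCount n L j ≤ N := by
      refine le_trans ?_ hN
      obtain ⟨m, hm⟩ : ∃ m, n = m + 1 := ⟨n - 1, by omega⟩
      have := j.2
      rw [risingCount, hm, Nat.add_sub_cancel, Nat.add_mul]
      omega
    have h2 : ∀ i : Fin N, (f.1 (Q (cellPath n L j i 1))).trace =
        if (i : ℕ) < risingCount n L j then T (j + 1) else T j := fun i => by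
      rw [cellPath_one]
      split_ifs <;> rfl
    rw [Finset.sum_congr rfl fun i _ => h2 i, sum_fin_ite h1]
    ring
  rw [Finset.sum_congr rfl fun j _ => hr j,
    ← Finset.sum_range fun j => (risingCount n L j : ℂ) * (T (j + 1) - T j) + N * T j,
    Finset.sum_add_distrib, sum_risingCount_mul_sub, ← Finset.mul_sum, hT0, hTL,
    Nat.cast_sub (Nat.one_le_iff_ne_zero.2 (NeZero.ne n))]
  push_cast
  ring

theorem blockDiagonal_ite_apply {A : Type*} [NonUnitalCStarAlgebra A] {N K : ℕ}
    (q : A →⋆ₙₐ[ℂ] Matrix (Fin K) (Fin K) ℂ) (f : A) :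
    blockRep (fun i : Fin N => if (i : ℕ) + 1 < N then q else 0) f =
      Matrix.blockDiagonal fun i : Fin N => if (i : ℕ) + 1 < N then q f else 0 := by
  rw [blockRep_apply]
  congr 1
  funext i
  split_ifs <;> rfl

/-- For every faithful diffuse trace there are trace preserving homomorphisms to Razak blocks with
the Lebesgue trace for which all the pointwise traces are close to the given trace. -/
theorem exists_hom_lebesgueTrace {τ : RazakBlock n k →L[ℂ] ℂ} (Q : C(unitInterval, unitInterval))
    (hQ0 : Q 0 = 0) (hQ1 : Q 1 = 1)
    (hτ : ∀ f, τ f = ∫ t, normTrace (Fin k × Fin n) (f.1 (Q t))) {L N K : ℕ} (hL : 0 < L)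
    (hN : n * L ≤ N) (E : (Fin k × Fin n) × Fin L ≃ Fin K) :
    ∃ ψ : RazakBlock n k →⋆ₙₐ[ℂ] RazakBlock N K, SendsTrace ψ τ (lebesgueTrace N K) ∧
      ∀ (f : RazakBlock n k) (ε : ℝ), (∀ s t : unitInterval, |(s : ℝ) - t| ≤ 1 / L →
        ‖f.1 (Q s) - f.1 (Q t)‖ ≤ ε) → ∀ t,
        ‖normTrace (Fin K × Fin N) ((ψ f).1 t) - τ f‖ ≤ ‖normTrace (Fin k × Fin n)‖ * ε := by
  have hN0 : 0 < N := (Nat.mul_pos (NeZero.pos n) hL).trans_le hN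
  obtain ⟨u, hu1, hu2, hu⟩ := gridRep_one_uEquiv hL hN E Q hQ0 hQ1
  -- Conjugating by this path, from 1 to u, leaves the correct value at 0 alone and turns the value
  -- at 1 into diag(q, …, q, 0).
  obtain ⟨γ⟩ := joined_one_unitary
    (⟨u, Unitary.mem_iff.2 ⟨hu2, hu1⟩⟩ : unitary (Matrix (Fin K × Fin N) (Fin K × Fin N) ℂ))
  let R : unitInterval → RazakBlock n k →⋆ₙₐ[ℂ] Matrix (Fin K × Fin N) (Fin K × Fin N) ℂ :=
    fun t => gridRep E fun (i : Fin N) (j : Fin L) => Q (cellPath n L j i t)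
  have hRcont : ∀ f, Continuous fun t => R t f := fun f => by
    change Continuous fun t => Matrix.blockDiagonal fun i : Fin N => (Matrix.blockDiagonal
      fun j : Fin L => f.1 (Q (cellPath n L j i t))).submatrix E.symm E.symm
    refine Continuous.matrix_blockDiagonal (continuous_pi fun i => ?_)
    refine Continuous.matrix_submatrix ?_ _ _
    refine Continuous.matrix_blockDiagonal (continuous_pi fun j => ?_)
    exact (map_continuous f.1).comp ((map_continuous Q).comp (map_continuous _))
  let U : unitInterval → Matrix (Fin K × Fin N) (Fin K × Fin N) ℂ := fun t => (γ t : Matrix _ _ ℂ)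
  have hUcont : Continuous U := continuous_subtype_val.comp (map_continuous γ)
  have hUU : ∀ t, star (U t) * U t = 1 := fun t => (Unitary.mem_iff.1 (γ t).2).1
  have hU0 : U 0 = 1 := by simp [U]
  have hU1 : U 1 = u := by simp [U]
  let q := reindexRep E (blockRep fun j : Fin L => pointRep (n := n) (k := k) (Q (gridPoint L j)))
  let ψ : RazakBlock n k →⋆ₙₐ[ℂ] RazakBlock N K :=
    { toFun := fun f => ⟨⟨fun t => U t * R t f * star (U t),
        (hUcont.mul (hRcont f)).mul hUcont.star⟩, q f, by
          change U 0 * R 0 f * star (U 0) = _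
          rw [hU0, star_one, mul_one, one_mul]
          change blockRep (fun i : Fin N => reindexRep E (blockRep fun j : Fin L =>
            pointRep (Q (cellPath n L j i 0)))) f = _
          simp only [cellPath_zero]
          rfl, by
          change U 1 * R 1 f * star (U 1) = _
          rw [hU1, Matrix.star_eq_conjTranspose, ← hu, blockDiagonal_ite_apply]⟩
      map_smul' := fun c f => RazakBlock.ext_apply fun t => by
        change U t * R t (c • f) * star (U t) = c • (U t * R t f * star (U t))
        rw [map_smul, Matrix.mul_smul, Matrix.smul_mul]
      map_zero' := RazakBlock.ext_apply fun t => by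
        change U t * R t 0 * star (U t) = 0
        rw [map_zero, mul_zero, zero_mul]
      map_add' := fun f g => RazakBlock.ext_apply fun t => by
        change U t * R t (f + g) * star (U t) =
          U t * R t f * star (U t) + U t * R t g * star (U t)
        rw [map_add, mul_add, add_mul]
      map_mul' := fun f g => RazakBlock.ext_apply fun t => by
        change U t * R t (f * g) * star (U t) =
          (U t * R t f * star (U t)) * (U t * R t g * star (U t))
        rw [map_mul]
        calc U t * (R t f * R t g) * star (U t)
            = U t * R t f * (1 * R t g) * star (U t) := by simp only [one_mul, mul_assoc]
          _ = _ := by rw [← hUU t]; simp only [mul_assoc]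
      map_star' := fun f => RazakBlock.ext_apply fun t => by
        change U t * R t (star f) * star (U t) = star (U t * R t f * star (U t))
        rw [map_star, star_mul, star_mul, star_star, mul_assoc] }
  have htr : ∀ f t, normTrace (Fin K × Fin N) ((ψ f).1 t) = ((N : ℂ) * L)⁻¹ *
      ∑ i : Fin N, ∑ j : Fin L, normTrace (Fin k × Fin n) (f.1 (Q (cellPath n L j i t))) :=
    fun f t => by
      rw [← normTrace_gridRep E]
      change normTrace (Fin K × Fin N) (U t * R t f * star (U t)) = normTrace _ (R t f)
      rw [normTrace_apply, normTrace_apply, Matrix.trace_mul_comm, ← mul_assoc, hUU, one_mul]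
  let g : RazakBlock n k → C(unitInterval, ℂ) := fun f =>
    ⟨fun t => normTrace (Fin k × Fin n) (f.1 (Q t)), (normTrace (Fin k × Fin n)).continuous.comp
      ((map_continuous f.1).comp (map_continuous Q))⟩
  have hNL : (N : ℂ) * L ≠ 0 := by
    have := Nat.mul_pos hN0 hL
    exact_mod_cast this.ne'
  have hint : ∀ f (i j : ℕ), Integrable fun s => g f (cellPath n L j i s) := fun f i j =>
    ((g f).comp (cellPath n L j i)).continuous.integrable_of_hasCompactSupport
      (HasCompactSupport.of_compactSpace _)
  -- Rising or tent, every path in cell j integrates to the mean over that cell, so averaging over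
  -- copies and cells recovers τ.
  have hsum : ∀ f, τ f = ((N : ℂ) * L)⁻¹ *
      ∑ i : Fin N, ∑ j : Fin L, ∫ s, g f (cellPath n L j i s) := fun f => by
    simp only [integral_cellPath]
    rw [Finset.sum_const, Finset.card_univ, Fintype.card_fin,
      ← Finset.sum_range fun j => ∫ s, g f (cellMap L j s), sum_integral_cellMap hL, nsmul_eq_mul,
      ← mul_assoc (N : ℂ), ← mul_assoc, inv_mul_cancel₀ hNL, one_mul]
    exact hτ f
  refine ⟨ψ, fun f => ?_, fun f ε hf t => ?_⟩
  · rw [hsum, lebesgueTrace, measureTrace_apply]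
    simp only [htr]
    rw [integral_const_mul]
    change _ = _ * ∫ s, ∑ i : Fin N, ∑ j : Fin L, g f (cellPath n L j i s)
    rw [integral_finsetSum _ fun (i : Fin N) _ =>
      integrable_finsetSum _ fun (j : Fin L) _ => hint f i j]
    congr 1
    refine Finset.sum_congr rfl fun i _ => ?_
    rw [integral_finsetSum _ fun (j : Fin L) _ => hint f i j]
  · have hε : 0 ≤ ‖normTrace (Fin k × Fin n)‖ * ε :=
      mul_nonneg (norm_nonneg _) ((norm_nonneg _).trans (hf 0 0 (by simp)))
    rw [htr, hsum, ← mul_sub, ← Finset.sum_sub_distrib]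
    simp only [← Finset.sum_sub_distrib]
    rw [norm_mul, norm_inv, inv_mul_le_iff₀ (norm_pos_iff.2 hNL)]
    have hterm : ∀ (i : Fin N) (j : Fin L), ‖normTrace (Fin k × Fin n)
        (f.1 (Q (cellPath n L j i t))) - ∫ s, g f (cellPath n L j i s)‖ ≤
          ‖normTrace (Fin k × Fin n)‖ * ε := fun i j => by
      have e : normTrace (Fin k × Fin n) (f.1 (Q (cellPath n L j i t))) -
          ∫ s, g f (cellPath n L j i s) =
          ∫ s, (normTrace (Fin k × Fin n) (f.1 (Q (cellPath n L j i t))) -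
            g f (cellPath n L j i s)) := by
        rw [integral_sub (integrable_const _) (hint f i j)]
        simp
      rw [e]
      refine (norm_integral_le_of_norm_le_const (C := ‖normTrace (Fin k × Fin n)‖ * ε)
        (Filter.Eventually.of_forall fun s => ?_)).trans (by simp)
      change ‖normTrace (Fin k × Fin n) (f.1 (Q (cellPath n L j i t))) -
        normTrace (Fin k × Fin n) (f.1 (Q (cellPath n L j i s)))‖ ≤ _
      rw [← map_sub]
      exact (ContinuousLinearMap.le_opNorm _ _).trans (mul_le_mul_of_nonneg_left
        (hf _ _ (cellPath_dist n L j i t s)) (norm_nonneg _))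
    refine (norm_sum_le_of_le _ fun i _ => norm_sum_le_of_le _ fun j _ => hterm i j).trans ?_
    simp
    exact (mul_assoc _ _ _).ge

end Existence

/-! ### Fibrewise comparison and the conclusion -/

/-- The value at 0 is n copies of the value at infinity, so trace estimates at t = 0 carry over to
the fibre at infinity. -/
theorem normTrace_inftyRep {n k : ℕ} [NeZero n] (f : RazakBlock n k) :
    normTrace (Fin k) (inftyRep f) = normTrace (Fin k × Fin n) (f.1 0) := by
  have hn : (n : ℂ) ≠ 0 := by exact_mod_cast NeZero.ne n
  rw [normTrace_apply, normTrace_apply, RazakBlock.trace_apply_zero]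
  simp only [Fintype.card_prod, Fintype.card_fin, Nat.cast_mul]
  rw [mul_inv, mul_assoc, inv_mul_cancel_left₀ hn]

theorem normTrace_inftyRep_comp {A : Type*} [NonUnitalCStarAlgebra A] {n k : ℕ} [NeZero n]
    (θ : A →⋆ₙₐ[ℂ] RazakBlock n k) (f : A) :
    normTrace (Fin k) (inftyRep.comp θ f) = normTrace (Fin k × Fin n) ((θ f).1 0) :=
  normTrace_inftyRep (θ f)

theorem normTrace_pointRep_comp {A : Type*} [NonUnitalCStarAlgebra A] {n k : ℕ}
    (θ : A →⋆ₙₐ[ℂ] RazakBlock n k) (t : unitInterval) (f : A) :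
    normTrace (Fin k × Fin n) ((pointRep t).comp θ f) = normTrace (Fin k × Fin n) ((θ f).1 t) :=
  rfl

section Fibres

variable {n₀ k₀ n k : ℕ} {σ : RazakBlock n₀ k₀ →L[ℂ] ℂ} {F G : Set (RazakBlock n₀ k₀)} {c δ : ℝ}
  (θ₁ θ₂ : RazakBlock n₀ k₀ →⋆ₙₐ[ℂ] RazakBlock n k)

set_option maxHeartbeats 1000000 in
theorem unitaryDist_pointRep_comp_le (t : unitInterval)
    (h : ∀ π ρ : RazakBlock n₀ k₀ →⋆ₙₐ[ℂ] Matrix (Fin k × Fin n) (Fin k × Fin n) ℂ,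
      (∀ f ∈ F, ‖normTrace _ (π f) - σ f‖ ≤ δ) → (∀ f ∈ F, ‖normTrace _ (ρ f) - σ f‖ ≤ δ) →
      UNear G c π ρ)
    (h₁ : ∀ f ∈ F, ∀ t, ‖normTrace (Fin k × Fin n) ((θ₁ f).1 t) - σ f‖ ≤ δ)
    (h₂ : ∀ f ∈ F, ∀ t, ‖normTrace (Fin k × Fin n) ((θ₂ f).1 t) - σ f‖ ≤ δ) :
    unitaryDist G ((pointRep t).comp θ₁) ((pointRep t).comp θ₂) ≤ ENNReal.ofReal c := by
  refine UNear.unitaryDist_le (h _ _ ?_ ?_)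
  · intro f hf
    rw [normTrace_pointRep_comp]
    exact h₁ f hf t
  · intro f hf
    rw [normTrace_pointRep_comp]
    exact h₂ f hf t

set_option maxHeartbeats 1000000 in
theorem unitaryDist_inftyRep_comp_le [NeZero n]
    (h : ∀ π ρ : RazakBlock n₀ k₀ →⋆ₙₐ[ℂ] Matrix (Fin k) (Fin k) ℂ,
      (∀ f ∈ F, ‖normTrace _ (π f) - σ f‖ ≤ δ) → (∀ f ∈ F, ‖normTrace _ (ρ f) - σ f‖ ≤ δ) →
      UNear G c π ρ)
    (h₁ : ∀ f ∈ F, ∀ t, ‖normTrace (Fin k × Fin n) ((θ₁ f).1 t) - σ f‖ ≤ δ)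
    (h₂ : ∀ f ∈ F, ∀ t, ‖normTrace (Fin k × Fin n) ((θ₂ f).1 t) - σ f‖ ≤ δ) :
    unitaryDist G (inftyRep.comp θ₁) (inftyRep.comp θ₂) ≤ ENNReal.ofReal c := by
  refine UNear.unitaryDist_le (h _ _ ?_ ?_)
  · intro f hf
    rw [normTrace_inftyRep_comp]
    exact h₁ f hf 0
  · intro f hf
    rw [normTrace_inftyRep_comp]
    exact h₂ f hf 0

end Fibres

theorem eventually_trace_modulus {n k : ℕ} (F : Set (RazakBlock n k)) (hF : F.Finite)
    (Q : C(unitInterval, unitInterval)) {δ : ℝ} (hδ : 0 < δ) :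
    ∀ᶠ M : ℕ in Filter.atTop, ∀ f ∈ F, ∀ s t : unitInterval, |(s : ℝ) - t| ≤ 1 / M →
      ‖f.1 (Q s) - f.1 (Q t)‖ ≤ δ :=
  (Filter.eventually_all_finite hF).2 fun f _ => eventually_norm_sub_le (f.1.comp Q) 1 hδ

/-- The sizes are left free, subject to L ≥ M, N ≥ nL and K = knL, so that two different blocks can
be sent to a common target. -/
theorem exists_hom_trace_close {n k : ℕ} [NeZero n] [NeZero k] {τ : RazakBlock n k →L[ℂ] ℂ}
    (hτ : IsFaithfulDiffuseTrace τ) (F : Set (RazakBlock n k)) (hF : F.Finite) {δ : ℝ}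
    (hδ : 0 < δ) : ∀ᶠ M : ℕ in Filter.atTop, ∀ L N K : ℕ, M ≤ L → n * L ≤ N → K = k * n * L →
      ∃ ψ : RazakBlock n k →⋆ₙₐ[ℂ] RazakBlock N K, SendsTrace ψ τ (lebesgueTrace N K) ∧
        ∀ f ∈ F, ∀ t, ‖normTrace (Fin K × Fin N) ((ψ f).1 t) - τ f‖ ≤ δ := by
  obtain ⟨Q, h0, h1, hQ⟩ := hτ.exists_quantile
  have hC : 0 < ‖normTrace (Fin k × Fin n)‖ + 1 := by positivity
  filter_upwards [eventually_trace_modulus F hF Q (div_pos hδ hC), Filter.eventually_ge_atTop 1]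
    with M hM hM1 L N K hL hN hK
  obtain ⟨ψ, hψ, hψ'⟩ := exists_hom_lebesgueTrace Q h0 h1 hQ (hM1.trans hL) hN
    (Fintype.equivFinOfCardEq (by simp [hK]) : (Fin k × Fin n) × Fin L ≃ Fin K)
  refine ⟨ψ, hψ, fun f hf t => (hψ' f _ (fun s t hst => hM f hf s t (hst.trans ?_)) t).trans ?_⟩
  · have : (0 : ℝ) < M := by exact_mod_cast hM1
    gcongr
  · rw [mul_div_assoc', div_le_iff₀ hC]
    nlinarith

set_option maxHeartbeats 1000000 in
theorem theoremT (n₀ k₀ n₁ k₁ n₂ k₂ : ℕ)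
    [NeZero n₀] [NeZero k₀] [NeZero n₁] [NeZero k₁] [NeZero n₂] [NeZero k₂]
    (σ : RazakBlock n₀ k₀ →L[ℂ] ℂ) (hσ : IsFaithfulDiffuseTrace σ)
    (τ₁ : RazakBlock n₁ k₁ →L[ℂ] ℂ) (hτ₁ : IsFaithfulDiffuseTrace τ₁)
    (τ₂ : RazakBlock n₂ k₂ →L[ℂ] ℂ) (hτ₂ : IsFaithfulDiffuseTrace τ₂)
    (φ₁ : RazakBlock n₀ k₀ →⋆ₙₐ[ℂ] RazakBlock n₁ k₁) (hφ₁ : SendsTrace φ₁ σ τ₁)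
    (φ₂ : RazakBlock n₀ k₀ →⋆ₙₐ[ℂ] RazakBlock n₂ k₂) (hφ₂ : SendsTrace φ₂ σ τ₂)
    (G : Set (RazakBlock n₀ k₀)) (hG : G.Finite) (ε : ℝ) (hε : 0 < ε) :
    ∃ (n k : ℕ) (_ : NeZero n) (_ : NeZero k)
      (ψ₁ : RazakBlock n₁ k₁ →⋆ₙₐ[ℂ] RazakBlock n k)
      (ψ₂ : RazakBlock n₂ k₂ →⋆ₙₐ[ℂ] RazakBlock n k),
      SendsTrace ψ₁ τ₁ (lebesgueTrace n k) ∧ SendsTrace ψ₂ τ₂ (lebesgueTrace n k) ∧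
      (⨆ t ∈ Set.Ioo (0 : unitInterval) 1,
          unitaryDist G ((pointRep t).comp (ψ₁.comp φ₁)) ((pointRep t).comp (ψ₂.comp φ₂))) ⊔
        unitaryDist G (inftyRep.comp (ψ₁.comp φ₁)) (inftyRep.comp (ψ₂.comp φ₂))
        < ENNReal.ofReal ε := by
  obtain ⟨F, hF, δ, hδ, hnear⟩ := exists_uNear_of_trace_close hσ G hG (half_pos hε)
  obtain ⟨M, hM₁, hM₂, hM⟩ := ((exists_hom_trace_close hτ₁ (φ₁ '' F) (hF.image _) hδ).and
    ((exists_hom_trace_close hτ₂ (φ₂ '' F) (hF.image _) hδ).and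
      (Filter.eventually_ge_atTop 1))).exists
  have hp₁ := Nat.mul_pos (NeZero.pos k₁) (NeZero.pos n₁)
  have hp₂ := Nat.mul_pos (NeZero.pos k₂) (NeZero.pos n₂)
  -- The cell counts are chosen so that $k_1n_1L_1 = k_2n_2L_2$, which makes K common; N need only
  -- be large, so a maximum serves both maps.
  let L₁ := k₂ * n₂ * M
  let L₂ := k₁ * n₁ * M
  let N := max (n₁ * L₁) (n₂ * L₂)
  let K := k₁ * n₁ * L₁
  have hK : K = k₂ * n₂ * L₂ := by simp only [K, L₁, L₂]; ring
  have hL₁ : 0 < L₁ := Nat.mul_pos hp₂ hM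
  have hN : 0 < N := (Nat.mul_pos (NeZero.pos n₁) hL₁).trans_le (le_max_left _ _)
  obtain ⟨ψ₁, hψ₁, hclose₁⟩ := hM₁ L₁ N K (Nat.le_mul_of_pos_left _ hp₂) (le_max_left _ _) rfl
  obtain ⟨ψ₂, hψ₂, hclose₂⟩ := hM₂ L₂ N K (Nat.le_mul_of_pos_left _ hp₁) (le_max_right _ _) hK
  have : NeZero N := ⟨hN.ne'⟩
  have : NeZero K := ⟨(Nat.mul_pos hp₁ hL₁).ne'⟩
  have h₁ : ∀ f ∈ F, ∀ t, ‖normTrace (Fin K × Fin N) ((ψ₁ (φ₁ f)).1 t) - σ f‖ ≤ δ :=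
    fun f hf t => by
      rw [hφ₁ f]
      exact hclose₁ _ (Set.mem_image_of_mem _ hf) t
  have h₂ : ∀ f ∈ F, ∀ t, ‖normTrace (Fin K × Fin N) ((ψ₂ (φ₂ f)).1 t) - σ f‖ ≤ δ :=
    fun f hf t => by
      rw [hφ₂ f]
      exact hclose₂ _ (Set.mem_image_of_mem _ hf) t
  clear_value N K
  refine ⟨N, K, inferInstance, inferInstance, ψ₁, ψ₂, hψ₁, hψ₂, ?_⟩
  refine lt_of_le_of_lt (sup_le (iSup₂_le fun t _ => ?_) ?_)
    ((ENNReal.ofReal_lt_ofReal_iff hε).2 (half_lt_self hε))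
  · exact unitaryDist_pointRep_comp_le (ψ₁.comp φ₁) (ψ₂.comp φ₂) t (hnear _) h₁ h₂
  · exact unitaryDist_inftyRep_comp_le (ψ₁.comp φ₁) (ψ₂.comp φ₂) (hnear _) h₁ h₂
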